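/- Consider the Cauchy problem for the one-dimensional Chaplygin gas $$\partial_t\rho+\partial_x(\rho u)=0,\qquad \partial_t(\rho u)+\partial_x(\rho u^2+p)=0,\qquad p=p_0-\frac{\mu^2}{\rho}\qquad(t\ge 0,\ x\in\mathbb R),$$ with constants $\mu,p_0>0$ and initial data $\rho(0,\cdot)=\rho_0$, $u(0,\cdot)=u_0$, where $\rho_0,u_0$ are bounded and of class $C^k$ for some $2\le k\le\infty$, and $\int_{\mathbb R}\rho_0\,dx=\infty$. Put $\Lambda_\pm=u_0\pm\mu/\rho_0$ and assume that $\Lambda_-(x)<\Lambda_+(x)$ for all $x\in\mathbb R$ and that there are $\alpha_0<\beta_0$ with $$\Lambda_-(\alpha_0)=\Lambda_+(\beta_0)=0,\quad \Lambda_-'(\alpha_0)=\Lambda_+'(\beta_0)=0,\quad \Lambda_-''(\alpha_0)<0,\quad \Lambda_+''(\beta_0)>0,$$ and that $(\alpha_0,\beta_0)$ is the only pair $\alpha<\beta$ with $\Lambda_-(\alpha)=\Lambda_+(\beta)$ (the data lead to one singularity only). For $\alpha\le\beta$ let $$t(\alpha,\beta)=\int_\alpha^\beta\frac{d\zeta}{\Lambda_+(\zeta)-\Lambda_-(\zeta)},\qquad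 x(\alpha,\beta)=\frac12\Big\{\alpha+\beta+\int_\alpha^\beta\frac{\Lambda_+(\zeta)+\Lambda_-(\zeta)}{\Lambda_+(\zeta)-\Lambda_-(\zeta)}\,d\zeta\Big\},$$ and $(t_0,x_0)=(t,x)(\alpha_0,\beta_0)$, $\tilde t=t-t_0$, $\tilde x=x-x_0$. Then: 1. $(\alpha,\beta)\mapsto(t,x)$ is a bijection from $\{\alpha\le\beta\}$ onto $\{t\ge0\}\times\mathbb R$. Denote its inverse by $(\alpha(t,x),\beta(t,x))$ and set $\lambda_-=\Lambda_-(\alpha(t,x))$, $\lambda_+=\Lambda_+(\beta(t,x))$. The functions $\lambda_\pm$ are continuous and solve the system $\partial_t\lambda_-+\lambda_+\partial_x\lambda_-=0$, $\partial_t\lambda_++\lambda_-\partial_x\lambda_+=0$, $\lambda_\pm(0,\cdot)=\Lambda_\pm$ along characteristics: through every point $(t,x)$ with $t\ge 0$ there is a curve down to time $0$ of speed $\lambda_-$ (respectively $\lambda_+$) along which $\lambda_+$ (respectively $\lambda_-$) keeps its initial value. Put $u=\frac12(\lambda_++\lambda_-)$ and $\rho=2\mu/(\lambda_+-\lambda_-)\in(0,\infty]$.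 2. There are positive constants $B_1,\dots,B_5$, depending only on $\mu,\Lambda_+(\alpha_0),\Lambda_-(\beta_0),\Lambda_-''(\alpha_0),\Lambda_+''(\beta_0)$, and for each $c>0$ a positive constant $B_6=B_6(c)$ depending only on $c$ and these numbers, such that, as $(t,x)\to(t_0,x_0)$, $(t,x)\ne(t_0,x_0)$, one eventually has $$\rho\le\begin{cases}B_1|\tilde t|^{-2}&\text{if }\tilde x=o(\tilde t^3),\\ B_2|\tilde x|^{-2/3}&\text{if }\tilde t^3=o(\tilde x),\\ B_3|\tilde x|^{-2/3}&\text{if }c|\tilde t|^3\le|\tilde x|\le C|\tilde t|^3,\end{cases}\qquad |u|\le\begin{cases}B_4|\tilde t|^{2}&\text{if }\tilde x=o(\tilde t^3),\\ B_5|\tilde x|^{2/3}&\text{if }\tilde t^3=o(\tilde x),\\ B_6|\tilde x|^{2/3}&\text{if }c|\tilde t|^3\le|\tilde x|\le C|\tilde t|^3,\end{cases}$$ for every way of approach (filter) satisfying the respective condition, and for all $c,C>0$ in the third case. 3. $(\rho,u)$ is a Delta-like solution with point-shape singularity. That is: $\rho=\infty$ exactly at the single point $(t_0,x_0)$, and $\rho\to\infty$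 there; on $\{t\ge0\}\setminus\{(t_0,x_0)\}$ the functions $\rho>0$ and $u$ are finite and of class $C^k$ (up to $t=0$); and $U=(\rho,\rho u)$, with flux $f(U)=(\rho u,\rho u^2+p)$ and initial value $U_0=(\rho_0,\rho_0u_0)$ bounded and measurable, is a global weak solution: $U$ is measurable, and for every $\phi\in C^1$ with compact support (not necessarily zero at $t=0$) the functions $U\phi_t$ and $f(U)\phi_x$ are integrable over $\{t\ge0\}$ and $$\iint_{t\ge0}\big(U\phi_t+f(U)\phi_x\big)\,dx\,dt+\int_{\mathbb R}U_0(x)\,\phi(0,x)\,dx=0 .$$ -/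

import Mathlib

open MeasureTheory Set Filter Topology Asymptotics
open scoped ENNReal

noncomputable section

namespace Chaplygin

/-- The closed half-plane `t ≥ 0`; points are written `(t, x)`. -/
def halfPlane : Set (ℝ × ℝ) := {p | 0 ≤ p.1}

/-! ### Conservation laws and weak solutions -/

/-- `U` is a (possibly unbounded) weak solution of `U_t + f(U)_x = 0`, `U(0, ·) = U₀`, with bounded
measurable initial data.  Test functions are `C¹` with compact support; they need not vanish at
`t = 0`.  Convergence of the integrals is part of the notion. -/
structure IsWeakSolution {n : ℕ} (f : (Fin n → ℝ) → (Fin n → ℝ)) (U₀ : ℝ → Fin n → ℝ)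
    (U : ℝ × ℝ → Fin n → ℝ) : Prop where
  measurable_data : Measurable U₀
  bounded_data : ∃ M : ℝ, ∀ x i, |U₀ x i| ≤ M
  measurable : Measurable (halfPlane.domRestrict U)
  integrable_time : ∀ φ : ℝ × ℝ → ℝ, ContDiff ℝ 1 φ → HasCompactSupport φ → ∀ i,
    IntegrableOn (fun p => U p i * fderiv ℝ φ p (1, 0)) halfPlane
  integrable_space : ∀ φ : ℝ × ℝ → ℝ, ContDiff ℝ 1 φ → HasCompactSupport φ → ∀ i,
    IntegrableOn (fun p => f (U p) i * fderiv ℝ φ p (0, 1)) halfPlane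
  weak_eq : ∀ φ : ℝ × ℝ → ℝ, ContDiff ℝ 1 φ → HasCompactSupport φ → ∀ i,
    (∫ p in halfPlane, (U p i * fderiv ℝ φ p (1, 0) + f (U p) i * fderiv ℝ φ p (0, 1)))
      + ∫ x, U₀ x i * φ (0, x) = 0

/-- The pressure law `p = p₀ - μ² / ρ`. -/
def pressure (μ p₀ ρ : ℝ) : ℝ := p₀ - μ ^ 2 / ρ

/-- The flux `(ρ, m) ↦ (m, m² / ρ + p(ρ))` of the gas equations in the conserved variables
`(ρ, m) = (ρ, ρ u)`; so the second component is `ρ u² + p(ρ)`. -/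
def flux (μ p₀ : ℝ) (U : Fin 2 → ℝ) : Fin 2 → ℝ :=
  ![U 1, (U 1) ^ 2 / U 0 + pressure μ p₀ (U 0)]

/-- `(ρ, u)` is a Delta-like solution of class `C^k` of the Cauchy problem for the Chaplygin gas,
with singular set `S`: the density takes values in `[0, ∞]`, is infinite exactly on `S` (and tends
to infinity there), `(ρ, u)` is `C^k` off `S` (up to `t = 0`), and `(ρ, ρ u)` is a weak solution.
Since `S` is a null set, the value of `ρ.toReal` on `S` does not matter. -/
structure IsDeltaLikeSolution (k : ℕ∞) (μ p₀ : ℝ) (ρ₀ u₀ : ℝ → ℝ)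
    (ρ : ℝ × ℝ → ℝ≥0∞) (u : ℝ × ℝ → ℝ) (S : Set (ℝ × ℝ)) : Prop where
  subset : S ⊆ halfPlane
  null : volume S = 0
  infinite : ∀ p ∈ S, ρ p = ⊤
  blowup : ∀ p ∈ S, Tendsto ρ (𝓝[halfPlane \ S] p) (𝓝 ⊤)
  finite : ∀ p ∈ halfPlane \ S, ρ p ≠ ⊤
  pos : ∀ p ∈ halfPlane \ S, 0 < ρ p
  smooth_density : ContDiffOn ℝ k (fun p => (ρ p).toReal) (halfPlane \ S)
  smooth_velocity : ContDiffOn ℝ k u (halfPlane \ S)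
  weak : IsWeakSolution (flux μ p₀) (fun x => ![ρ₀ x, ρ₀ x * u₀ x])
    (fun p => ![(ρ p).toReal, (ρ p).toReal * u p])

/-! ### The solution given by the method of characteristics -/

/-- The initial value `Λ₋ = u₀ - μ / ρ₀` of the Riemann invariant `λ₋ = u - c`. -/
def LamM (μ : ℝ) (ρ₀ u₀ : ℝ → ℝ) (x : ℝ) : ℝ := u₀ x - μ / ρ₀ x

/-- The initial value `Λ₊ = u₀ + μ / ρ₀` of the Riemann invariant `λ₊ = u + c`. -/
def LamP (μ : ℝ) (ρ₀ u₀ : ℝ → ℝ) (x : ℝ) : ℝ := u₀ x + μ / ρ₀ x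

/-- The characteristic map `Π(α, β) = (t(α, β), x(α, β))`: the point where the characteristic
`x⁻` (of speed `λ₊`) issuing from `(0, α)` meets the characteristic `x⁺` (of speed `λ₋`) issuing
from `(0, β)`. -/
def charMap (Λm Λp : ℝ → ℝ) (q : ℝ × ℝ) : ℝ × ℝ :=
  (∫ ζ in q.1..q.2, 1 / (Λp ζ - Λm ζ),
   (q.1 + q.2 + ∫ ζ in q.1..q.2, (Λp ζ + Λm ζ) / (Λp ζ - Λm ζ)) / 2)

/-- The set `α ≤ β` of characteristic parameters. -/
def paramSet : Set (ℝ × ℝ) := {q | q.1 ≤ q.2}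

/-- The characteristic parameters `(α(t, x), β(t, x))` of a point: the inverse of `charMap`. -/
def charParam (Λm Λp : ℝ → ℝ) : ℝ × ℝ → ℝ × ℝ :=
  Function.invFunOn (charMap Λm Λp) paramSet

/-- `λ₋(t, x) = Λ₋(α(t, x))`. -/
def lamM (Λm Λp : ℝ → ℝ) (p : ℝ × ℝ) : ℝ := Λm (charParam Λm Λp p).1

/-- `λ₊(t, x) = Λ₊(β(t, x))`. -/
def lamP (Λm Λp : ℝ → ℝ) (p : ℝ × ℝ) : ℝ := Λp (charParam Λm Λp p).2

/-- The velocity `u = (λ₊ + λ₋) / 2`. -/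
def velocity (Λm Λp : ℝ → ℝ) (p : ℝ × ℝ) : ℝ := (lamP Λm Λp p + lamM Λm Λp p) / 2

/-- The density `ρ = 2 μ / (λ₊ - λ₋)`, with value `∞` where `λ₊ = λ₋`. -/
def density (μ : ℝ) (Λm Λp : ℝ → ℝ) (p : ℝ × ℝ) : ℝ≥0∞ :=
  ENNReal.ofReal (2 * μ) / ENNReal.ofReal (lamP Λm Λp p - lamM Λm Λp p)

/-- `(lm, lp)` solves `∂ₜλ₋ + λ₊ ∂ₓλ₋ = 0`, `∂ₜλ₊ + λ₋ ∂ₓλ₊ = 0`, `λ±(0, ·) = Λ±`, in the sense of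
characteristics on the whole half-plane `t ≥ 0`: both functions are continuous, each point is joined
to `t = 0` by a characteristic of speed `lm`, along which `lp` keeps its initial value, and by a
characteristic of speed `lp`, along which `lm` keeps its initial value. -/
structure IsCharacteristicSolution (Λm Λp : ℝ → ℝ) (lm lp : ℝ × ℝ → ℝ) : Prop where
  continuous_lm : ContinuousOn lm halfPlane
  continuous_lp : ContinuousOn lp halfPlane
  plus : ∀ t x : ℝ, 0 ≤ t → ∃ f : ℝ → ℝ, f t = x ∧ ∀ s ∈ Icc 0 t,
    HasDerivWithinAt f (lm (s, f s)) (Icc 0 t) s ∧ lp (s, f s) = Λp (f 0)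
  minus : ∀ t x : ℝ, 0 ≤ t → ∃ f : ℝ → ℝ, f t = x ∧ ∀ s ∈ Icc 0 t,
    HasDerivWithinAt f (lp (s, f s)) (Icc 0 t) s ∧ lm (s, f s) = Λm (f 0)

/-- The values at `α₀` and `β₀` on which the constants of the estimates may depend. -/
structure LocalData where
  mu : ℝ
  lamP_alpha : ℝ
  lamM_beta : ℝ
  lamM_alpha_deriv2 : ℝ
  lamP_beta_deriv2 : ℝ

/-- The numbers `μ, Λ₊(α₀), Λ₋(β₀), Λ₋''(α₀), Λ₊''(β₀)`. -/
def localData (μ : ℝ) (Λm Λp : ℝ → ℝ) (α₀ β₀ : ℝ) : LocalData where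
  mu := μ
  lamP_alpha := Λp α₀
  lamM_beta := Λm β₀
  lamM_alpha_deriv2 := deriv (deriv Λm) α₀
  lamP_beta_deriv2 := deriv (deriv Λp) β₀

end Chaplygin

end

open Chaplygin

namespace Chaplygin

/-! ### Characteristic data and the primitives entering the characteristic map -/

/-! Take the mass coordinate `m = massCoord` with `m' = 1 / (Λ₊ - Λ₋)`. The characteristic map then
separates: `t = m(β) - m(α)` and `x = posP(β) - posM(α)` (`charMap_eq`). At fixed `t`, with `a =
m(α)` and `m(β) = a + t`, one has `dx/da = Λ₊(β) - Λ₋(α)`. By the gap condition this is nonnegative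
and vanishes at most at the singular parameter, so `x` is strictly increasing in `a`. Infinite mass
and bounded velocity make the map onto and proper, hence its inverse is continuous. The Jacobian is
a negative multiple of `Λ₊(β) - Λ₋(α)`, so the inverse function theorem gives regularity off one
point.

Near that point put `r = m(β) - m(β₀)` and `q = m(α) - m(α₀)`. Then `t - t₀ = r - q`, while `λ₊` and
`-λ₋` are comparable to `r²` and `q²`, and `x - x₀` is a sum of two increasing terms comparable to
`r³` and `q³`. With `N = |r| + |q|` the gap `λ₊ - λ₋` is of order `N²`, and either `N ≤ 4 |t - t₀|`
or `|x - x₀|` is at least of order `N³` (`eventually_singularScale`). All the estimates follow from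
this.

For the weak equations, the Jacobian cancels the blow-up of the density. In the variables `(α, β)`
each balance law becomes `∂_β(w₁(α) φ) + ∂_α(w₂(β) φ)`, whose integral leaves only the diagonal `α =
β`, that is, the initial line (`weak_balance`). -/

/-- The standing assumptions on `Λ₋`, `Λ₊` that are used for the global solution. -/
structure CharData (Λm Λp : ℝ → ℝ) (α₀ β₀ : ℝ) : Prop where
  cont_m : Continuous Λm
  cont_p : Continuous Λp
  lt : ∀ x, Λm x < Λp x
  bdd : ∃ M, ∀ x, |Λp x + Λm x| ≤ M
  mass : ¬ Integrable (fun x => 1 / (Λp x - Λm x))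
  sing_lt : α₀ < β₀
  sing_eq : Λm α₀ = Λp β₀
  gap : ∀ α β, α ≤ β → (α, β) ≠ (α₀, β₀) → Λm α < Λp β

/-- The density `1 / (Λ₊ - Λ₋)` of the Lagrangian mass coordinate. -/
noncomputable def massDensity (Λm Λp : ℝ → ℝ) (y : ℝ) : ℝ := 1 / (Λp y - Λm y)

/-- The Lagrangian mass coordinate. -/
noncomputable def massCoord (Λm Λp : ℝ → ℝ) (y : ℝ) : ℝ := ∫ ζ in (0 : ℝ)..y, massDensity Λm Λp ζ

/-- The contribution of `β` to the position `x(α, β)`. -/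
noncomputable def posP (Λm Λp : ℝ → ℝ) (y : ℝ) : ℝ :=
  ∫ ζ in (0 : ℝ)..y, Λp ζ * massDensity Λm Λp ζ

/-- Minus the contribution of `α` to the position `x(α, β)`. -/
noncomputable def posM (Λm Λp : ℝ → ℝ) (y : ℝ) : ℝ :=
  ∫ ζ in (0 : ℝ)..y, Λm ζ * massDensity Λm Λp ζ

/-- The inverse of the mass coordinate. -/
noncomputable def massInv (Λm Λp : ℝ → ℝ) : ℝ → ℝ := Function.invFun (massCoord Λm Λp)

/-- The gap condition: a continuous `Λ₊(β) - Λ₋(α)` that is positive on the diagonal and has a single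
zero in `α < β` is positive at all other points, because each of them is joined to the diagonal by
a vertical or horizontal segment that avoids the zero. -/
theorem gap_of_unique {Λm Λp : ℝ → ℝ} {α₀ β₀ : ℝ} (hm : Continuous Λm) (hp : Continuous Λp)
    (hlt : ∀ x, Λm x < Λp x)
    (huniq : ∀ α β, α < β → Λm α = Λp β → α = α₀ ∧ β = β₀) (α β : ℝ) (h : α ≤ β)
    (hne : (α, β) ≠ (α₀, β₀)) : Λm α < Λp β := by
  by_contra hcon
  push Not at hcon
  obtain ⟨s, hs, hs0⟩ : ∃ s ∈ Icc α β, Λm s = Λp β := by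
    have := intermediate_value_Icc' h hm.continuousOn
    exact this ⟨(hlt β).le, hcon⟩
  obtain ⟨r, hr, hr0⟩ : ∃ r ∈ Icc α β, Λp r = Λm α := by
    have := intermediate_value_Icc' h hp.continuousOn
    exact this ⟨hcon, (hlt α).le⟩
  have hsβ : s < β := lt_of_le_of_ne hs.2 (by rintro rfl; exact (hlt s).ne hs0)
  have hrα : α < r := lt_of_le_of_ne hr.1 (by rintro rfl; exact (hlt α).ne hr0.symm)
  -- The zero `(s, β)` forces `β = β₀` and the zero `(α, r)` forces `α = α₀`; together they give the
  -- excluded point.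
  have h1 := huniq s β hsβ hs0
  have h2 := huniq α r hrα hr0.symm
  exact hne (by rw [h1.2, h2.1])

variable {Λm Λp : ℝ → ℝ} {α₀ β₀ : ℝ}

namespace CharData

theorem massDensity_pos (h : CharData Λm Λp α₀ β₀) (y : ℝ) : 0 < massDensity Λm Λp y :=
  one_div_pos.2 (sub_pos.2 (h.lt y))

/-- The source of `posP - posM = id`, through which `x(α, β)` splits into a function of `β` minus a
function of `α`. -/
theorem massDensity_mul (h : CharData Λm Λp α₀ β₀) (y : ℝ) :
    Λp y * massDensity Λm Λp y - Λm y * massDensity Λm Λp y = 1 := by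
  have := (sub_pos.2 (h.lt y)).ne'
  unfold massDensity
  field_simp

theorem continuous_massDensity (h : CharData Λm Λp α₀ β₀) : Continuous (massDensity Λm Λp) :=
  continuous_const.div (h.cont_p.sub h.cont_m) fun y => (sub_pos.2 (h.lt y)).ne'

theorem hasStrictDerivAt_massCoord (h : CharData Λm Λp α₀ β₀) (y : ℝ) :
    HasStrictDerivAt (massCoord Λm Λp) (massDensity Λm Λp y) y :=
  h.continuous_massDensity.integral_hasStrictDerivAt 0 y

theorem hasStrictDerivAt_posP (h : CharData Λm Λp α₀ β₀) (y : ℝ) :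
    HasStrictDerivAt (posP Λm Λp) (Λp y * massDensity Λm Λp y) y :=
  (h.cont_p.mul h.continuous_massDensity).integral_hasStrictDerivAt 0 y

theorem hasStrictDerivAt_posM (h : CharData Λm Λp α₀ β₀) (y : ℝ) :
    HasStrictDerivAt (posM Λm Λp) (Λm y * massDensity Λm Λp y) y :=
  (h.cont_m.mul h.continuous_massDensity).integral_hasStrictDerivAt 0 y

theorem continuous_massCoord (h : CharData Λm Λp α₀ β₀) : Continuous (massCoord Λm Λp) :=
  continuous_iff_continuousAt.2 fun y => (h.hasStrictDerivAt_massCoord y).hasDerivAt.continuousAt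

theorem continuous_posP (h : CharData Λm Λp α₀ β₀) : Continuous (posP Λm Λp) :=
  continuous_iff_continuousAt.2 fun y => (h.hasStrictDerivAt_posP y).hasDerivAt.continuousAt

theorem continuous_posM (h : CharData Λm Λp α₀ β₀) : Continuous (posM Λm Λp) :=
  continuous_iff_continuousAt.2 fun y => (h.hasStrictDerivAt_posM y).hasDerivAt.continuousAt

theorem strictMono_massCoord (h : CharData Λm Λp α₀ β₀) : StrictMono (massCoord Λm Λp) :=
  strictMono_of_hasDerivAt_pos (fun y => (h.hasStrictDerivAt_massCoord y).hasDerivAt)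
    h.massDensity_pos

theorem integral_massDensity (h : CharData Λm Λp α₀ β₀) (a b : ℝ) :
    ∫ ζ in a..b, massDensity Λm Λp ζ = massCoord Λm Λp b - massCoord Λm Λp a :=
  intervalIntegral.integral_eq_sub_of_hasDerivAt
    (fun y _ => (h.hasStrictDerivAt_massCoord y).hasDerivAt)
    (h.continuous_massDensity.intervalIntegrable _ _)

/-- The position `x(α, β)` relative to the midpoint of `[α, β]`. -/
theorem integral_sum_mul (h : CharData Λm Λp α₀ β₀) (a b : ℝ) :
    ∫ ζ in a..b, (Λp ζ + Λm ζ) * massDensity Λm Λp ζ =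
      2 * (posP Λm Λp b - posM Λm Λp a) - (a + b) := by
  have hd : ∀ y, HasDerivAt (fun y => posP Λm Λp y + posM Λm Λp y)
      ((Λp y + Λm y) * massDensity Λm Λp y) y := fun y => by
    refine ((h.hasStrictDerivAt_posP y).hasDerivAt.add
      (h.hasStrictDerivAt_posM y).hasDerivAt).congr_deriv ?_
    ring
  have hdiff : ∀ y, posP Λm Λp y - posM Λm Λp y = y := by
    have hd' : ∀ y, HasDerivAt (fun y => posP Λm Λp y - posM Λm Λp y - y) 0 y := fun y => by
      refine (((h.hasStrictDerivAt_posP y).hasDerivAt.sub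
        (h.hasStrictDerivAt_posM y).hasDerivAt).sub (hasDerivAt_id y)).congr_deriv ?_
      rw [h.massDensity_mul]
      ring
    intro y
    have := is_const_of_deriv_eq_zero (fun y => (hd' y).differentiableAt) (fun y => (hd' y).deriv)
      y 0
    simp [posP, posM] at this ⊢
    linarith
  rw [intervalIntegral.integral_eq_sub_of_hasDerivAt (fun y _ => hd y)
    (((h.cont_p.add h.cont_m).mul h.continuous_massDensity).intervalIntegrable _ _)]
  have := hdiff a
  have := hdiff b
  linarith

theorem charMap_eq (h : CharData Λm Λp α₀ β₀) (q : ℝ × ℝ) :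
    charMap Λm Λp q = (massCoord Λm Λp q.2 - massCoord Λm Λp q.1,
      posP Λm Λp q.2 - posM Λm Λp q.1) := by
  have h1 := h.integral_massDensity q.1 q.2
  have h2 := h.integral_sum_mul q.1 q.2
  simp only [massDensity, mul_one_div] at h1 h2
  simp only [charMap, h1, h2]
  ext <;> simp

theorem continuous_charMap (h : CharData Λm Λp α₀ β₀) : Continuous (charMap Λm Λp) := by
  have : charMap Λm Λp = fun q => (massCoord Λm Λp q.2 - massCoord Λm Λp q.1,
      posP Λm Λp q.2 - posM Λm Λp q.1) := funext h.charMap_eq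
  rw [this]
  exact ((h.continuous_massCoord.comp continuous_snd).sub
    (h.continuous_massCoord.comp continuous_fst)).prodMk
    ((h.continuous_posP.comp continuous_snd).sub (h.continuous_posM.comp continuous_fst))

theorem charMap_diag (a : ℝ) : charMap Λm Λp (a, a) = (0, a) := by
  simp [charMap]

/-! ### Infinite mass and properness of the characteristic map -/

/-- A positive function with bounded integrals along `[-K, K]` would be integrable. The mass may be
infinite on one side only, so both endpoints have to move. -/
theorem exists_mass_ge (h : CharData Λm Λp α₀ β₀) (T : ℝ) :
    ∃ K > 0, ∀ a b, a ≤ -K → K ≤ b → T < massCoord Λm Λp b - massCoord Λm Λp a := by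
  by_contra! hcon
  refine h.mass (integrable_of_intervalIntegral_norm_bounded (l := atTop)
    (a := fun K : ℝ => -K) (b := fun K : ℝ => K) T (fun K => ?_) tendsto_neg_atTop_atBot
    tendsto_id ?_)
  · exact (h.continuous_massDensity.continuousOn.integrableOn_Icc (a := -K) (b := K)).mono_set
      Ioc_subset_Icc_self
  · filter_upwards [eventually_gt_atTop (0 : ℝ)] with K hK
    obtain ⟨a, b, ha, hb, hab⟩ := hcon K hK
    have h1 : ∀ x, ‖1 / (Λp x - Λm x)‖ = massDensity Λm Λp x := fun x =>
      Real.norm_of_nonneg (h.massDensity_pos x).le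
    simp only [h1]
    rw [h.integral_massDensity]
    have := h.strictMono_massCoord.monotone ha
    have := h.strictMono_massCoord.monotone hb
    linarith

/-- Finite speed: `x(α, β)` stays within `M t / 2` of the midpoint of `[α, β]`. -/
theorem abs_pos_sub_le (h : CharData Λm Λp α₀ β₀) {M : ℝ} (hM : ∀ x, |Λp x + Λm x| ≤ M)
    {q : ℝ × ℝ} (hq : q ∈ paramSet) :
    |2 * (charMap Λm Λp q).2 - (q.1 + q.2)| ≤ M * (charMap Λm Λp q).1 := by
  rw [h.charMap_eq, ← h.integral_sum_mul, ← h.integral_massDensity,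
    ← intervalIntegral.integral_const_mul]
  have hint : IntervalIntegrable (fun ζ => M * massDensity Λm Λp ζ) volume q.1 q.2 :=
    (continuous_const.mul h.continuous_massDensity).intervalIntegrable _ _
  rw [← Real.norm_eq_abs]
  refine intervalIntegral.norm_integral_le_of_norm_le hq (ae_of_all _ fun x _ => ?_) hint
  rw [Real.norm_eq_abs, abs_mul, abs_of_pos (h.massDensity_pos x)]
  exact mul_le_mul_of_nonneg_right (hM x) (h.massDensity_pos x).le

/-- Properness of the characteristic map on `paramSet`. Infinite mass prevents `α → -∞` and `β → ∞`
from happening together within bounded time, and the midpoint bound prevents either from happening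
alone. -/
theorem bdd_param (h : CharData Λm Λp α₀ β₀) (R : ℝ) :
    ∃ N, ∀ q ∈ paramSet, |(charMap Λm Λp q).1| ≤ R → |(charMap Λm Λp q).2| ≤ R →
      |q.1| ≤ N ∧ |q.2| ≤ N := by
  obtain ⟨M, hM⟩ := h.bdd
  have hM0 : 0 ≤ M := (abs_nonneg _).trans (hM 0)
  obtain ⟨K, hK, hKm⟩ := h.exists_mass_ge R
  refine ⟨K + (2 * |R| + M * |R|), fun q hq ht hx => ?_⟩
  have h1 := h.abs_pos_sub_le hM hq
  have h2 : M * (charMap Λm Λp q).1 ≤ M * |R| :=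
    mul_le_mul_of_nonneg_left ((le_abs_self _).trans (ht.trans (le_abs_self _))) hM0
  have h3 : |q.1 + q.2| ≤ 2 * |R| + M * |R| := by
    have hR := le_abs_self R
    rw [abs_le] at *
    constructor <;> linarith [hx.1, hx.2, h1.1, h1.2]
  have hRR : 0 ≤ 2 * |R| + M * |R| := (abs_nonneg _).trans h3
  have hq' : q.1 ≤ q.2 := hq
  have h4 : ¬ (q.1 ≤ -K ∧ K ≤ q.2) := fun hh => by
    have := hKm _ _ hh.1 hh.2
    rw [h.charMap_eq] at ht
    have := (abs_le.1 ht).2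
    simp only at this
    linarith
  rw [abs_le] at h3
  rw [abs_le, abs_le]
  by_cases h5 : q.1 ≤ -K
  · have : q.2 < K := not_le.1 fun h6 => h4 ⟨h5, h6⟩
    refine ⟨⟨?_, ?_⟩, ?_, ?_⟩ <;> linarith
  · have : -K < q.1 := not_le.1 h5
    refine ⟨⟨?_, ?_⟩, ?_, ?_⟩ <;> linarith

/-! ### The inverse of the mass coordinate -/

theorem massInv_massCoord (h : CharData Λm Λp α₀ β₀) (y : ℝ) :
    massInv Λm Λp (massCoord Λm Λp y) = y :=
  Function.leftInverse_invFun h.strictMono_massCoord.injective y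

/-- The range can be a proper subinterval of `ℝ`, since one of the two half-lines may carry finite
mass; hence the range hypotheses here and below. -/
theorem massCoord_massInv {m : ℝ} (hm : m ∈ range (massCoord Λm Λp)) :
    massCoord Λm Λp (massInv Λm Λp m) = m :=
  Function.invFun_eq hm

theorem hasDerivAt_massInv (h : CharData Λm Λp α₀ β₀) {m : ℝ}
    (hm : m ∈ range (massCoord Λm Λp)) :
    HasDerivAt (massInv Λm Λp) (massDensity Λm Λp (massInv Λm Λp m))⁻¹ m := by
  obtain ⟨y, rfl⟩ := hm
  rw [h.massInv_massCoord]
  have hd := h.hasStrictDerivAt_massCoord y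
  have hne := (h.massDensity_pos y).ne'
  -- By injectivity of `massCoord`, the globally chosen inverse agrees near the point with the local
  -- inverse of the inverse function theorem.
  refine (hd.to_localInverse hne).hasDerivAt.congr_of_eventuallyEq ?_
  have hF := hd.hasStrictFDerivAt_equiv hne
  filter_upwards [hF.eventually_right_inverse] with m hm
  conv_lhs => rw [← hm]
  rw [h.massInv_massCoord]

/-- The range of the mass coordinate is an interval. -/
theorem mem_range_massCoord (h : CharData Λm Λp α₀ β₀) {a b m : ℝ}
    (hm : m ∈ Icc (massCoord Λm Λp a) (massCoord Λm Λp b)) : m ∈ range (massCoord Λm Λp) :=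
  mem_range_of_exists_le_of_exists_ge h.continuous_massCoord ⟨a, hm.1⟩ ⟨b, hm.2⟩

/-! ### Bijectivity of the characteristic map -/

/-- In the mass coordinate the weight cancels and the derivative is exactly the characteristic
speed. -/
theorem hasDerivAt_posP_massInv (h : CharData Λm Λp α₀ β₀) {m : ℝ}
    (hm : m ∈ range (massCoord Λm Λp)) :
    HasDerivAt (fun m => posP Λm Λp (massInv Λm Λp m)) (Λp (massInv Λm Λp m)) m := by
  refine ((h.hasStrictDerivAt_posP _).hasDerivAt.comp m (h.hasDerivAt_massInv hm)).congr_deriv ?_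
  rw [mul_assoc, mul_inv_cancel₀ (h.massDensity_pos _).ne', mul_one]

theorem hasDerivAt_posM_massInv (h : CharData Λm Λp α₀ β₀) {m : ℝ}
    (hm : m ∈ range (massCoord Λm Λp)) :
    HasDerivAt (fun m => posM Λm Λp (massInv Λm Λp m)) (Λm (massInv Λm Λp m)) m := by
  refine ((h.hasStrictDerivAt_posM _).hasDerivAt.comp m (h.hasDerivAt_massInv hm)).congr_deriv ?_
  rw [mul_assoc, mul_inv_cancel₀ (h.massDensity_pos _).ne', mul_one]

theorem ordConnected_range_massCoord (h : CharData Λm Λp α₀ β₀) :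
    (range (massCoord Λm Λp)).OrdConnected :=
  (isPreconnected_range h.continuous_massCoord).ordConnected

theorem massInv_le_massInv (h : CharData Λm Λp α₀ β₀) {m n : ℝ}
    (hm : m ∈ range (massCoord Λm Λp)) (hn : n ∈ range (massCoord Λm Λp)) (hmn : m ≤ n) :
    massInv Λm Λp m ≤ massInv Λm Λp n := by
  rw [← h.strictMono_massCoord.le_iff_le, massCoord_massInv hm, massCoord_massInv hn]
  exact hmn

/-- The position at time `t` as a function of the Lagrangian mass coordinate of `α`. -/
theorem hasDerivAt_position (h : CharData Λm Λp α₀ β₀) {t m : ℝ}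
    (hm : m ∈ range (massCoord Λm Λp)) (hmt : m + t ∈ range (massCoord Λm Λp)) :
    HasDerivAt (fun m => posP Λm Λp (massInv Λm Λp (m + t)) - posM Λm Λp (massInv Λm Λp m))
      (Λp (massInv Λm Λp (m + t)) - Λm (massInv Λm Λp m)) m :=
  ((h.hasDerivAt_posP_massInv hmt).comp_add_const m t).sub (h.hasDerivAt_posM_massInv hm)

/-- The derivative is nonnegative and can vanish only where `massInv m = α₀`, thus for at most one
`m`. The interval is cut in two and the mean value theorem is applied to each half: at most one of
the two slopes is zero. -/
theorem position_lt (h : CharData Λm Λp α₀ β₀) {t a b : ℝ} (ht : 0 ≤ t) (hab : a < b)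
    (ha : a ∈ range (massCoord Λm Λp)) (hb : b ∈ range (massCoord Λm Λp))
    (hat : a + t ∈ range (massCoord Λm Λp)) (hbt : b + t ∈ range (massCoord Λm Λp)) :
    posP Λm Λp (massInv Λm Λp (a + t)) - posM Λm Λp (massInv Λm Λp a) <
      posP Λm Λp (massInv Λm Λp (b + t)) - posM Λm Λp (massInv Λm Λp b) := by
  have hR := h.ordConnected_range_massCoord
  have hm : ∀ m ∈ Icc a b, m ∈ range (massCoord Λm Λp) := fun m hm => hR.out ha hb hm
  have hmt : ∀ m ∈ Icc a b, m + t ∈ range (massCoord Λm Λp) := fun m hm =>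
    hR.out hat hbt ⟨by linarith [hm.1], by linarith [hm.2]⟩
  set f := fun m => posP Λm Λp (massInv Λm Λp (m + t)) - posM Λm Λp (massInv Λm Λp m) with hf
  set f' := fun m => Λp (massInv Λm Λp (m + t)) - Λm (massInv Λm Λp m) with hf'
  have hd : ∀ m ∈ Icc a b, HasDerivAt f (f' m) m := fun m hmm =>
    h.hasDerivAt_position (hm m hmm) (hmt m hmm)
  have hle : ∀ m ∈ Icc a b, massInv Λm Λp m ≤ massInv Λm Λp (m + t) := fun m hmm =>
    h.massInv_le_massInv (hm m hmm) (hmt m hmm) (by linarith)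
  have hpos : ∀ m ∈ Icc a b, massInv Λm Λp m ≠ α₀ → 0 < f' m := fun m hmm hne =>
    sub_pos.2 (h.gap _ _ (hle m hmm) fun hh => hne (congrArg Prod.fst hh))
  have hnn : ∀ m ∈ Icc a b, 0 ≤ f' m := fun m hmm => by
    by_cases hh : (massInv Λm Λp m, massInv Λm Λp (m + t)) = (α₀, β₀)
    · rw [hf']
      simp only [Prod.mk.injEq] at hh
      simp only [hh.1, hh.2, h.sing_eq, sub_self, le_refl]
    · exact (sub_pos.2 (h.gap _ _ (hle m hmm) hh)).le
  obtain ⟨c, hac, hcb⟩ := exists_between hab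
  obtain ⟨c₁, hc₁, e₁⟩ := exists_hasDerivAt_eq_slope f f' hac
    (fun m hm => (hd m ⟨hm.1, hm.2.trans hcb.le⟩).continuousAt.continuousWithinAt)
    (fun m hm => hd m ⟨hm.1.le, hm.2.le.trans hcb.le⟩)
  obtain ⟨c₂, hc₂, e₂⟩ := exists_hasDerivAt_eq_slope f f' hcb
    (fun m hm => (hd m ⟨hac.le.trans hm.1, hm.2⟩).continuousAt.continuousWithinAt)
    (fun m hm => hd m ⟨hac.le.trans hm.1.le, hm.2.le⟩)
  have m₁ : c₁ ∈ Icc a b := ⟨hc₁.1.le, hc₁.2.le.trans hcb.le⟩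
  have m₂ : c₂ ∈ Icc a b := ⟨hac.le.trans hc₂.1.le, hc₂.2.le⟩
  rw [eq_div_iff (sub_pos.2 hac).ne'] at e₁
  rw [eq_div_iff (sub_pos.2 hcb).ne'] at e₂
  have n₁ := mul_nonneg (hnn c₁ m₁) (sub_pos.2 hac).le
  have n₂ := mul_nonneg (hnn c₂ m₂) (sub_pos.2 hcb).le
  change f a < f b
  by_cases hh : massInv Λm Λp c₁ = α₀
  · have : massInv Λm Λp c₂ ≠ α₀ := fun hh' => by
      have : c₁ = c₂ := by
        rw [← massCoord_massInv (hm _ m₁), ← massCoord_massInv (hm _ m₂), hh, hh']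
      exact (hc₁.2.trans hc₂.1).ne this
    have := mul_pos (hpos c₂ m₂ this) (sub_pos.2 hcb)
    linarith
  · have := mul_pos (hpos c₁ m₁ hh) (sub_pos.2 hac)
    linarith

theorem charMap_fst_nonneg (h : CharData Λm Λp α₀ β₀) {q : ℝ × ℝ} (hq : q ∈ paramSet) :
    0 ≤ (charMap Λm Λp q).1 := by
  rw [h.charMap_eq]
  exact sub_nonneg.2 (h.strictMono_massCoord.monotone hq)

theorem charMap_snd_eq (h : CharData Λm Λp α₀ β₀) (q : ℝ × ℝ) :
    (charMap Λm Λp q).2 =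
      posP Λm Λp (massInv Λm Λp (massCoord Λm Λp q.1 + (charMap Λm Λp q).1)) -
        posM Λm Λp (massInv Λm Λp (massCoord Λm Λp q.1)) := by
  rw [h.charMap_eq, add_sub_cancel, h.massInv_massCoord, h.massInv_massCoord]

theorem massCoord_add_mem (h : CharData Λm Λp α₀ β₀) (q : ℝ × ℝ) :
    massCoord Λm Λp q.1 + (charMap Λm Λp q).1 ∈ range (massCoord Λm Λp) := by
  rw [h.charMap_eq, add_sub_cancel]
  exact mem_range_self _

theorem charMap_snd_lt (h : CharData Λm Λp α₀ β₀) {q r : ℝ × ℝ} (hq : q ∈ paramSet)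
    (ht : (charMap Λm Λp q).1 = (charMap Λm Λp r).1) (hqr : q.1 < r.1) :
    (charMap Λm Λp q).2 < (charMap Λm Λp r).2 := by
  rw [h.charMap_snd_eq q, h.charMap_snd_eq r, ← ht]
  refine h.position_lt (h.charMap_fst_nonneg hq) (h.strictMono_massCoord hqr) (mem_range_self _)
    (mem_range_self _) (h.massCoord_add_mem q) ?_
  rw [ht]
  exact h.massCoord_add_mem r

theorem injOn_charMap (h : CharData Λm Λp α₀ β₀) : InjOn (charMap Λm Λp) paramSet := by
  intro q hq r hr hqr
  have ht := congrArg Prod.fst hqr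
  have hx := congrArg Prod.snd hqr
  rcases lt_trichotomy q.1 r.1 with hlt | heq | hgt
  · exact absurd hx (h.charMap_snd_lt hq ht hlt).ne
  · refine Prod.ext heq (h.strictMono_massCoord.injective ?_)
    rw [h.charMap_eq, h.charMap_eq] at ht
    simp only [heq] at ht
    linarith
  · exact absurd hx (h.charMap_snd_lt hr ht.symm hgt).ne'

theorem mapsTo_charMap (h : CharData Λm Λp α₀ β₀) :
    MapsTo (charMap Λm Λp) paramSet halfPlane :=
  fun _ hq => h.charMap_fst_nonneg hq

/-- At fixed `t` the position is continuous in the mass of `α`, so it suffices to find parameters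
with positions on either side of `x`. -/
theorem surjOn_charMap (h : CharData Λm Λp α₀ β₀) :
    SurjOn (charMap Λm Λp) paramSet halfPlane := by
  rintro ⟨t, x⟩ (ht : 0 ≤ t)
  obtain ⟨M, hM⟩ := h.bdd
  have hM0 : 0 ≤ M := (abs_nonneg _).trans (hM 0)
  obtain ⟨K, hK, hKm⟩ := h.exists_mass_ge t
  -- With `α = -(K + N)` the partner `b` is at most `K`, so the midpoint bound gives twice the
  -- position at most `-N + M t = -2 |x|`. The choice `β = K + N` is symmetric.
  set N := 2 * |x| + M * t with hN
  have hN0 : 0 ≤ N := by positivity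
  obtain ⟨b, hb, hbt⟩ : ∃ b ∈ Icc (-(K + N)) K,
      massCoord Λm Λp b = massCoord Λm Λp (-(K + N)) + t :=
    intermediate_value_Icc (by linarith) h.continuous_massCoord.continuousOn
      ⟨by linarith, by linarith [hKm (-(K + N)) K (by linarith) le_rfl]⟩
  obtain ⟨a, ha, hat⟩ : ∃ a ∈ Icc (-K) (K + N),
      massCoord Λm Λp a = massCoord Λm Λp (K + N) - t :=
    intermediate_value_Icc (by linarith) h.continuous_massCoord.continuousOn
      ⟨by linarith [hKm (-K) (K + N) le_rfl (by linarith)], by linarith⟩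
  have e₁ : (charMap Λm Λp (-(K + N), b)).1 = t := by rw [h.charMap_eq]; simp [hbt]
  have e₂ : (charMap Λm Λp (a, K + N)).1 = t := by rw [h.charMap_eq]; simp [hat]
  have b₁ := h.abs_pos_sub_le hM (q := (-(K + N), b)) hb.1
  have b₂ := h.abs_pos_sub_le hM (q := (a, K + N)) ha.2
  rw [e₁, abs_le] at b₁
  rw [e₂, abs_le] at b₂
  have l₁ : (charMap Λm Λp (-(K + N), b)).2 ≤ x := by
    have := neg_abs_le x
    have := b₁.2
    have := hb.2
    simp only at *
    linarith
  have l₂ : x ≤ (charMap Λm Λp (a, K + N)).2 := by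
    have := le_abs_self x
    have := b₂.1
    have := ha.1
    simp only at *
    linarith
  rw [h.charMap_snd_eq, e₁] at l₁
  rw [h.charMap_snd_eq, e₂] at l₂
  have m₁ := h.massCoord_add_mem (-(K + N), b)
  have m₂ := h.massCoord_add_mem (a, K + N)
  rw [e₁] at m₁
  rw [e₂] at m₂
  have hR := h.ordConnected_range_massCoord
  have hsub : uIcc (massCoord Λm Λp (-(K + N))) (massCoord Λm Λp a) ⊆ range (massCoord Λm Λp) :=
    hR.uIcc_subset (mem_range_self _) (mem_range_self _)
  have hsubt : ∀ m ∈ uIcc (massCoord Λm Λp (-(K + N))) (massCoord Λm Λp a),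
      m + t ∈ range (massCoord Λm Λp) := fun m hm => by
    refine hR.uIcc_subset m₁ m₂ ?_
    rw [mem_uIcc] at hm ⊢
    rcases hm with hm | hm
    · left; constructor <;> linarith [hm.1, hm.2]
    · right; constructor <;> linarith [hm.1, hm.2]
  obtain ⟨m, hm, hmx⟩ := intermediate_value_uIcc
    (f := fun m => posP Λm Λp (massInv Λm Λp (m + t)) - posM Λm Λp (massInv Λm Λp m))
    (fun m hm => (h.hasDerivAt_position (hsub hm) (hsubt m hm)).continuousAt.continuousWithinAt)
    (Icc_subset_uIcc ⟨l₁, l₂⟩)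
  refine ⟨(massInv Λm Λp m, massInv Λm Λp (m + t)),
    h.massInv_le_massInv (hsub hm) (hsubt m hm) (by linarith), ?_⟩
  rw [h.charMap_eq]
  simp only [massCoord_massInv (hsub hm), massCoord_massInv (hsubt m hm)]
  exact Prod.ext (by simp) hmx

theorem bijOn_charMap (h : CharData Λm Λp α₀ β₀) :
    BijOn (charMap Λm Λp) paramSet halfPlane :=
  ⟨h.mapsTo_charMap, h.injOn_charMap, h.surjOn_charMap⟩

theorem charParam_mem (h : CharData Λm Λp α₀ β₀) {p : ℝ × ℝ} (hp : p ∈ halfPlane) :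
    charParam Λm Λp p ∈ paramSet :=
  Function.invFunOn_mem (h.surjOn_charMap hp)

theorem charMap_charParam (h : CharData Λm Λp α₀ β₀) {p : ℝ × ℝ} (hp : p ∈ halfPlane) :
    charMap Λm Λp (charParam Λm Λp p) = p :=
  Function.invFunOn_eq (h.surjOn_charMap hp)

theorem charParam_charMap (h : CharData Λm Λp α₀ β₀) {q : ℝ × ℝ} (hq : q ∈ paramSet) :
    charParam Λm Λp (charMap Λm Λp q) = q :=
  h.injOn_charMap.leftInvOn_invFunOn hq

theorem sing_mem (h : CharData Λm Λp α₀ β₀) : (α₀, β₀) ∈ paramSet := h.sing_lt.le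

/-- The inverse of a proper continuous injection is continuous: near `p` the parameters stay in a
compact set, and each cluster point is mapped to `p`, hence is the parameter of `p`. -/
theorem continuousOn_charParam (h : CharData Λm Λp α₀ β₀) :
    ContinuousOn (charParam Λm Λp) halfPlane := by
  intro p hp
  obtain ⟨N, hN⟩ := h.bdd_param (|p.1| + |p.2| + 1)
  have hcl : IsClosed paramSet := isClosed_le continuous_fst continuous_snd
  have hs : IsCompact ((Icc (-N) N ×ˢ Icc (-N) N) ∩ paramSet) :=
    (isCompact_Icc.prod isCompact_Icc).inter_right hcl
  refine hs.tendsto_nhds_of_unique_mapClusterPt ?_ ?_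
  · have h1 : ∀ᶠ p' : ℝ × ℝ in 𝓝 p, |p'.1| < |p.1| + |p.2| + 1 :=
      (continuous_fst.abs.tendsto p).eventually_lt_const
        (by linarith [abs_nonneg p.2])
    have h2 : ∀ᶠ p' : ℝ × ℝ in 𝓝 p, |p'.2| < |p.1| + |p.2| + 1 :=
      (continuous_snd.abs.tendsto p).eventually_lt_const
        (by linarith [abs_nonneg p.1])
    filter_upwards [self_mem_nhdsWithin, nhdsWithin_le_nhds h1, nhdsWithin_le_nhds h2]
      with p' hp' h1 h2
    have hmem := h.charParam_mem hp'
    have := hN _ hmem (by rw [h.charMap_charParam hp']; exact h1.le)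
      (by rw [h.charMap_charParam hp']; exact h2.le)
    exact ⟨⟨abs_le.1 this.1, abs_le.1 this.2⟩, hmem⟩
  · rintro q ⟨-, hq⟩ hcl
    have h1 : MapClusterPt (charMap Λm Λp q) (𝓝[halfPlane] p)
        (charMap Λm Λp ∘ charParam Λm Λp) :=
      hcl.continuousAt_comp h.continuous_charMap.continuousAt
    have h2 : Tendsto (charMap Λm Λp ∘ charParam Λm Λp) (𝓝[halfPlane] p) (𝓝 p) := by
      refine (tendsto_id.mono_left nhdsWithin_le_nhds).congr' ?_
      filter_upwards [self_mem_nhdsWithin] with p' hp'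
      exact (h.charMap_charParam hp').symm
    have h3 : charMap Λm Λp q = p := by
      have : ClusterPt (charMap Λm Λp q) (𝓝 p) := ClusterPt.mono h1 h2
      exact eq_of_nhds_neBot this
    rw [← h3, h.charParam_charMap hq]

theorem continuousOn_lamM (h : CharData Λm Λp α₀ β₀) : ContinuousOn (lamM Λm Λp) halfPlane :=
  h.cont_m.comp_continuousOn (continuous_fst.comp_continuousOn h.continuousOn_charParam)

theorem continuousOn_lamP (h : CharData Λm Λp α₀ β₀) : ContinuousOn (lamP Λm Λp) halfPlane :=
  h.cont_p.comp_continuousOn (continuous_snd.comp_continuousOn h.continuousOn_charParam)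

/-! ### Characteristics -/

/-- On a characteristic one parameter is frozen and the mass of the other moves at unit rate, since
`t` is a difference of masses. The derivatives of `posM` and `posP` in the mass coordinate are then
the required speeds. -/
theorem isCharacteristicSolution (h : CharData Λm Λp α₀ β₀) :
    IsCharacteristicSolution Λm Λp (lamM Λm Λp) (lamP Λm Λp) where
  continuous_lm := h.continuousOn_lamM
  continuous_lp := h.continuousOn_lamP
  plus t x ht := by
    have hp : ((t, x) : ℝ × ℝ) ∈ halfPlane := ht
    have hq := h.charMap_charParam hp
    have hqm := h.charParam_mem hp
    set q := charParam Λm Λp (t, x)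
    rw [h.charMap_eq] at hq
    simp only [Prod.mk.injEq] at hq
    obtain ⟨hqt, hqx⟩ := hq
    have hrange : ∀ s ∈ Icc 0 t, massCoord Λm Λp q.2 - s ∈ range (massCoord Λm Λp) :=
      fun s hs => h.mem_range_massCoord (a := q.1) (b := q.2)
        ⟨by linarith [hs.2], by linarith [hs.1]⟩
    have hpar : ∀ s ∈ Icc 0 t,
        charParam Λm Λp (s, posP Λm Λp q.2 - posM Λm Λp (massInv Λm Λp (massCoord Λm Λp q.2 - s)))
          = (massInv Λm Λp (massCoord Λm Λp q.2 - s), q.2) := fun s hs => by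
      have hm : (massInv Λm Λp (massCoord Λm Λp q.2 - s), q.2) ∈ paramSet := by
        change massInv Λm Λp (massCoord Λm Λp q.2 - s) ≤ q.2
        rw [← h.strictMono_massCoord.le_iff_le, massCoord_massInv (hrange s hs)]
        linarith [hs.1]
      rw [← h.charParam_charMap hm, h.charMap_eq]
      simp only [massCoord_massInv (hrange s hs), sub_sub_cancel]
    refine ⟨fun s => posP Λm Λp q.2 - posM Λm Λp (massInv Λm Λp (massCoord Λm Λp q.2 - s)),
      ?_, fun s hs => ⟨?_, ?_⟩⟩
    · have : massCoord Λm Λp q.2 - t = massCoord Λm Λp q.1 := by linarith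
      simp only [this, h.massInv_massCoord]
      exact hqx
    · rw [lamM, hpar s hs]
      refine HasDerivAt.hasDerivWithinAt ?_
      refine (((h.hasDerivAt_posM_massInv (hrange s hs)).comp_const_sub
        (massCoord Λm Λp q.2) s).const_sub (posP Λm Λp q.2)).congr_deriv (neg_neg _)
    · rw [lamP, hpar s hs]
      -- At `s = 0` both parameters equal `q.2`, so the curve starts at `x = q.2`.
      have h0 := congrArg Prod.snd (h.charMap_eq (q.2, q.2))
      rw [charMap_diag] at h0
      simp only [sub_zero, h.massInv_massCoord] at h0 ⊢
      rw [← h0]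
  minus t x ht := by
    have hp : ((t, x) : ℝ × ℝ) ∈ halfPlane := ht
    have hq := h.charMap_charParam hp
    have hqm := h.charParam_mem hp
    set q := charParam Λm Λp (t, x)
    rw [h.charMap_eq] at hq
    simp only [Prod.mk.injEq] at hq
    obtain ⟨hqt, hqx⟩ := hq
    have hrange : ∀ s ∈ Icc 0 t, massCoord Λm Λp q.1 + s ∈ range (massCoord Λm Λp) :=
      fun s hs => h.mem_range_massCoord (a := q.1) (b := q.2)
        ⟨by linarith [hs.1], by linarith [hs.2]⟩
    have hpar : ∀ s ∈ Icc 0 t,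
        charParam Λm Λp (s, posP Λm Λp (massInv Λm Λp (massCoord Λm Λp q.1 + s)) - posM Λm Λp q.1)
          = (q.1, massInv Λm Λp (massCoord Λm Λp q.1 + s)) := fun s hs => by
      have hm : (q.1, massInv Λm Λp (massCoord Λm Λp q.1 + s)) ∈ paramSet := by
        change q.1 ≤ massInv Λm Λp (massCoord Λm Λp q.1 + s)
        rw [← h.strictMono_massCoord.le_iff_le, massCoord_massInv (hrange s hs)]
        linarith [hs.1]
      rw [← h.charParam_charMap hm, h.charMap_eq]
      simp only [massCoord_massInv (hrange s hs), add_sub_cancel_left]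
    refine ⟨fun s => posP Λm Λp (massInv Λm Λp (massCoord Λm Λp q.1 + s)) - posM Λm Λp q.1,
      ?_, fun s hs => ⟨?_, ?_⟩⟩
    · have : massCoord Λm Λp q.1 + t = massCoord Λm Λp q.2 := by linarith
      simp only [this, h.massInv_massCoord]
      exact hqx
    · rw [lamP, hpar s hs]
      exact (((h.hasDerivAt_posP_massInv (hrange s hs)).comp_const_add
        (massCoord Λm Λp q.1) s).sub_const (posM Λm Λp q.1)).hasDerivWithinAt
    · rw [lamM, hpar s hs]
      have h0 := congrArg Prod.snd (h.charMap_eq (q.1, q.1))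
      rw [charMap_diag] at h0
      simp only [add_zero, h.massInv_massCoord] at h0 ⊢
      rw [← h0]

/-! ### Regularity away from the singular point -/

/-- The derivative of the characteristic map. -/
noncomputable def _root_.Chaplygin.charDeriv (Λm Λp : ℝ → ℝ) (q : ℝ × ℝ) : ℝ × ℝ →L[ℝ] ℝ × ℝ :=
  ContinuousLinearMap.prod
    (massDensity Λm Λp q.2 • ContinuousLinearMap.snd ℝ ℝ ℝ -
      massDensity Λm Λp q.1 • ContinuousLinearMap.fst ℝ ℝ ℝ)
    ((Λp q.2 * massDensity Λm Λp q.2) • ContinuousLinearMap.snd ℝ ℝ ℝ -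
      (Λm q.1 * massDensity Λm Λp q.1) • ContinuousLinearMap.fst ℝ ℝ ℝ)

theorem hasFDerivAt_charMap (h : CharData Λm Λp α₀ β₀) (q : ℝ × ℝ) :
    HasFDerivAt (charMap Λm Λp) (charDeriv Λm Λp q) q := by
  have : charMap Λm Λp = fun q => (massCoord Λm Λp q.2 - massCoord Λm Λp q.1,
      posP Λm Λp q.2 - posM Λm Λp q.1) := funext h.charMap_eq
  rw [this]
  exact (((h.hasStrictDerivAt_massCoord q.2).hasDerivAt.comp_hasFDerivAt q hasFDerivAt_snd).sub
    ((h.hasStrictDerivAt_massCoord q.1).hasDerivAt.comp_hasFDerivAt q hasFDerivAt_fst)).prodMk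
    (((h.hasStrictDerivAt_posP q.2).hasDerivAt.comp_hasFDerivAt q hasFDerivAt_snd).sub
    ((h.hasStrictDerivAt_posM q.1).hasDerivAt.comp_hasFDerivAt q hasFDerivAt_fst))

theorem _root_.Chaplygin.det_charDeriv (q : ℝ × ℝ) : (charDeriv Λm Λp q).det =
    -(massDensity Λm Λp q.1 * massDensity Λm Λp q.2 * (Λp q.2 - Λm q.1)) := by
  rw [ContinuousLinearMap.det, ← LinearMap.det_toMatrix (Module.Basis.finTwoProd ℝ),
    Matrix.det_fin_two]
  simp [LinearMap.toMatrix_apply, charDeriv]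
  ring

theorem det_charDeriv_ne_zero (h : CharData Λm Λp α₀ β₀) {q : ℝ × ℝ} (hq : q ∈ paramSet)
    (hne : q ≠ (α₀, β₀)) : (charDeriv Λm Λp q).det ≠ 0 := by
  rw [det_charDeriv]
  exact neg_ne_zero.2 (mul_pos (mul_pos (h.massDensity_pos _) (h.massDensity_pos _))
    (sub_pos.2 (h.gap _ _ hq hne))).ne'

theorem _root_.Chaplygin.contDiff_integral {n : ℕ∞} {f : ℝ → ℝ} (hf : ContDiff ℝ n f) :
    ContDiff ℝ n (fun y => ∫ ζ in (0 : ℝ)..y, f ζ) := by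
  have hd : ∀ y, HasDerivAt (fun y => ∫ ζ in (0 : ℝ)..y, f ζ) (f y) y := fun y =>
    (hf.continuous.integral_hasStrictDerivAt 0 y).hasDerivAt
  have : ContDiff ℝ (n + 1) (fun y => ∫ ζ in (0 : ℝ)..y, f ζ) := by
    refine contDiff_succ_iff_deriv.2 ⟨fun y => (hd y).differentiableAt, fun hn => ?_, ?_⟩
    -- The analytic case does not occur, because `n` is in `ℕ∞`.
    · exact absurd hn (WithTop.coe_ne_top)
    · rw [show deriv (fun y => ∫ ζ in (0 : ℝ)..y, f ζ) = f from funext fun y => (hd y).deriv]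
      exact hf
  exact this.of_le le_self_add

theorem contDiff_massDensity (h : CharData Λm Λp α₀ β₀) {k : ℕ∞} (hm : ContDiff ℝ k Λm)
    (hp : ContDiff ℝ k Λp) : ContDiff ℝ k (massDensity Λm Λp) :=
  contDiff_const.div (hp.sub hm) fun y => (sub_pos.2 (h.lt y)).ne'

theorem contDiff_charMap (h : CharData Λm Λp α₀ β₀) {k : ℕ∞} (hm : ContDiff ℝ k Λm)
    (hp : ContDiff ℝ k Λp) : ContDiff ℝ k (charMap Λm Λp) := by
  have : charMap Λm Λp = fun q => (massCoord Λm Λp q.2 - massCoord Λm Λp q.1,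
      posP Λm Λp q.2 - posM Λm Λp q.1) := funext h.charMap_eq
  rw [this]
  have hg := h.contDiff_massDensity hm hp
  have h1 : ContDiff ℝ k (massCoord Λm Λp) := contDiff_integral hg
  have h2 : ContDiff ℝ k (posP Λm Λp) := contDiff_integral (hp.mul hg)
  have h3 : ContDiff ℝ k (posM Λm Λp) := contDiff_integral (hm.mul hg)
  exact ((h1.comp contDiff_snd).sub (h1.comp contDiff_fst)).prodMk
    ((h2.comp contDiff_snd).sub (h3.comp contDiff_fst))

/-- The characteristic map is smooth on the whole plane, so the local inverse exists on a full
neighbourhood even at `t = 0`. Continuity of `charParam` keeps its values near `q`, where it must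
agree with that local inverse. -/
theorem contDiffWithinAt_charParam (h : CharData Λm Λp α₀ β₀) {k : ℕ∞} (hk : k ≠ 0)
    (hm : ContDiff ℝ k Λm) (hp : ContDiff ℝ k Λp) {p : ℝ × ℝ} (hpm : p ∈ halfPlane)
    (hne : p ≠ charMap Λm Λp (α₀, β₀)) :
    ContDiffWithinAt ℝ k (charParam Λm Λp) halfPlane p := by
  have hq := h.charParam_mem hpm
  have hqp := h.charMap_charParam hpm
  have hqne : charParam Λm Λp p ≠ (α₀, β₀) := fun e => hne (by rw [← hqp, e])
  set q := charParam Λm Λp p with hqdef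
  have hdet := h.det_charDeriv_ne_zero hq hqne
  set e := (charDeriv Λm Λp q).toContinuousLinearEquivOfDetNeZero hdet with he
  have hc : ContDiffAt ℝ k (charMap Λm Λp) q := (h.contDiff_charMap hm hp).contDiffAt
  have hk' : (k : WithTop ℕ∞) ≠ 0 := by exact_mod_cast hk
  have hd : HasFDerivAt (charMap Λm Λp) (e : ℝ × ℝ →L[ℝ] ℝ × ℝ) q := by
    rw [he, ContinuousLinearMap.coe_toContinuousLinearEquivOfDetNeZero]
    exact h.hasFDerivAt_charMap q
  have hinv := hc.to_localInverse hd hk'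
  rw [hqp] at hinv
  refine hinv.contDiffWithinAt.congr_of_eventuallyEq ?_ ?_
  · have hs := hc.hasStrictFDerivAt' hd hk'
    have hcont : Tendsto (charParam Λm Λp) (𝓝[halfPlane] p) (𝓝 q) :=
      h.continuousOn_charParam p hpm
    filter_upwards [hcont.eventually hs.eventually_left_inverse, self_mem_nhdsWithin] with p' h1 h2
    rw [h.charMap_charParam h2] at h1
    exact h1.symm
  · have hs := hc.hasStrictFDerivAt' hd hk'
    have := hs.eventually_left_inverse.self_of_nhds
    rw [hqp] at this
    exact this.symm

end CharData

/-! ### Local bounds in one variable -/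

theorem quadratic_bounds {f : ℝ → ℝ} {a D : ℝ} (hf : ContDiff ℝ 2 f) (h0 : f a = 0)
    (h1 : deriv f a = 0) (h2 : deriv (deriv f) a = D) (hD : 0 < D) :
    ∀ᶠ x in 𝓝 a, D / 4 * (x - a) ^ 2 ≤ f x ∧ f x ≤ D * (x - a) ^ 2 := by
  have ht := taylor_isLittleO_univ (f := f) (x₀ := a) (n := 2) (by exact_mod_cast hf)
  have hT : ∀ x, taylorWithinEval f 2 univ a x = D / 2 * (x - a) ^ 2 := fun x => by
    rw [taylorWithinEval_succ, taylorWithinEval_succ, taylor_within_zero_eval]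
    simp only [iteratedDerivWithin_univ, iteratedDeriv_succ, iteratedDeriv_zero, h0, h1, h2]
    simp
    ring
  -- The Taylor term is `D / 2 * (x - a) ^ 2`; an error of `D / 4` leaves coefficients between `D /
  -- 4` and `3 D / 4`.
  filter_upwards [ht.bound (show 0 < D / 4 by positivity)] with x hx
  rw [hT, Real.norm_eq_abs, Real.norm_of_nonneg (sq_nonneg _), abs_le] at hx
  have := mul_nonneg hD.le (sq_nonneg (x - a))
  constructor <;> linarith [hx.1, hx.2]

theorem linear_bounds {G : ℝ → ℝ} {a g : ℝ} (hG : HasDerivAt G g a) (hg : 0 < g) :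
    ∀ᶠ y in 𝓝 a, g / 2 * |y - a| ≤ |G y - G a| ∧ |G y - G a| ≤ 2 * g * |y - a| := by
  filter_upwards [hG.isLittleO.bound (show 0 < g / 2 by positivity)] with y hy
  simp only [Real.norm_eq_abs, smul_eq_mul] at hy
  have h1 : |(y - a) * g| = g * |y - a| := by rw [abs_mul, abs_of_pos hg, mul_comm]
  have h2 := abs_sub_abs_le_abs_sub ((y - a) * g) (G y - G a)
  have h3 := abs_sub_abs_le_abs_sub (G y - G a) ((y - a) * g)
  rw [abs_sub_comm ((y - a) * g)] at h2
  have := mul_nonneg hg.le (abs_nonneg (y - a))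
  constructor <;> linarith

theorem sign_of_deriv_nonneg {K K' : ℝ → ℝ} (hd : ∀ᶠ s in 𝓝 0, HasDerivAt K (K' s) s)
    (hnn : ∀ᶠ s in 𝓝 0, 0 ≤ K' s) (h0 : K 0 = 0) :
    ∀ᶠ s in 𝓝 0, (0 ≤ s → 0 ≤ K s) ∧ (s ≤ 0 → K s ≤ 0) := by
  obtain ⟨ε, hε, hb⟩ := Metric.eventually_nhds_iff_ball.1 (hd.and hnn)
  have hmono : MonotoneOn K (Metric.ball 0 ε) := by
    refine monotoneOn_of_deriv_nonneg (convex_ball 0 ε)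
      (fun s hs => (hb s hs).1.continuousAt.continuousWithinAt) (fun s hs => ?_) fun s hs => ?_
    · exact (hb s (interior_subset hs)).1.differentiableAt.differentiableWithinAt
    · have := hb s (interior_subset hs)
      rw [this.1.deriv]
      exact this.2
  filter_upwards [Metric.ball_mem_nhds 0 hε] with s hs
  have hz : (0 : ℝ) ∈ Metric.ball (0 : ℝ) ε := Metric.mem_ball_self hε
  exact ⟨fun h => h0 ▸ hmono hz hs h, fun h => h0 ▸ hmono hs hz h⟩

/-- The derivative bounds are integrated from `0`; for `s ≤ 0` the two cubic bounds change places.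
-/
theorem cubic_bounds {F F' : ℝ → ℝ} {c C : ℝ} (hd : ∀ᶠ s in 𝓝 0, HasDerivAt F (F' s) s)
    (hb : ∀ᶠ s in 𝓝 0, c * s ^ 2 ≤ F' s ∧ F' s ≤ C * s ^ 2) (h0 : F 0 = 0) :
    ∀ᶠ s in 𝓝 0, (0 ≤ s → c / 3 * s ^ 3 ≤ F s ∧ F s ≤ C / 3 * s ^ 3) ∧
      (s ≤ 0 → C / 3 * s ^ 3 ≤ F s ∧ F s ≤ c / 3 * s ^ 3) := by
  have hp : ∀ e s : ℝ, HasDerivAt (fun s => e / 3 * s ^ 3) (e * s ^ 2) s := fun e s => by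
    refine ((hasDerivAt_pow 3 s).const_mul (e / 3)).congr_deriv ?_
    norm_num
    ring
  have h1 := sign_of_deriv_nonneg (K := fun s => F s - c / 3 * s ^ 3)
    (hd.mono fun s hs => hs.sub (hp c s)) (hb.mono fun s hs => sub_nonneg.2 hs.1) (by simp [h0])
  have h2 := sign_of_deriv_nonneg (K := fun s => C / 3 * s ^ 3 - F s)
    (hd.mono fun s hs => (hp C s).sub hs) (hb.mono fun s hs => sub_nonneg.2 hs.2) (by simp [h0])
  filter_upwards [h1, h2] with s h1 h2
  exact ⟨fun h => ⟨sub_nonneg.1 (h1.1 h), sub_nonneg.1 (h2.1 h)⟩,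
    fun h => ⟨sub_nonpos.1 (h2.2 h), sub_nonpos.1 (h1.2 h)⟩⟩

namespace CharData

theorem range_massCoord_mem_nhds (h : CharData Λm Λp α₀ β₀) (a : ℝ) :
    range (massCoord Λm Λp) ∈ 𝓝 (massCoord Λm Λp a) :=
  mem_of_superset (Icc_mem_nhds (h.strictMono_massCoord (sub_one_lt a))
    (h.strictMono_massCoord (lt_add_one a))) fun _ hm => h.mem_range_massCoord hm

/-- Quadratic bounds for a function with a nondegenerate minimum `0`, in the mass coordinate. -/
theorem quadratic_bounds_mass (h : CharData Λm Λp α₀ β₀) {f : ℝ → ℝ} {a D g : ℝ}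
    (hf : ContDiff ℝ 2 f) (h0 : f a = 0) (h1 : deriv f a = 0) (h2 : deriv (deriv f) a = D)
    (hD : 0 < D) (hg : massDensity Λm Λp a = g) :
    ∀ᶠ s in 𝓝 0, D / (16 * g ^ 2) * s ^ 2 ≤ f (massInv Λm Λp (massCoord Λm Λp a + s)) ∧
      f (massInv Λm Λp (massCoord Λm Λp a + s)) ≤ 4 * D / g ^ 2 * s ^ 2 := by
  have hg0 : 0 < g := hg ▸ h.massDensity_pos a
  have hadd : Tendsto (fun s => massCoord Λm Λp a + s) (𝓝 0) (𝓝 (massCoord Λm Λp a)) := by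
    simpa using (continuous_const.add continuous_id).tendsto (x := (0 : ℝ))
      (f := fun s => massCoord Λm Λp a + s)
  have hinv : Tendsto (fun s => massInv Λm Λp (massCoord Λm Λp a + s)) (𝓝 0) (𝓝 a) := by
    have := (h.hasDerivAt_massInv (mem_range_self a)).continuousAt.tendsto.comp hadd
    rwa [h.massInv_massCoord] at this
  have hG : HasDerivAt (massCoord Λm Λp) g a := hg ▸ (h.hasStrictDerivAt_massCoord a).hasDerivAt
  filter_upwards [hinv.eventually (quadratic_bounds hf h0 h1 h2 hD),
    hinv.eventually (linear_bounds hG hg0), hadd (h.range_massCoord_mem_nhds a)] with s hq hl hr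
  rw [massCoord_massInv hr, add_sub_cancel_left] at hl
  set y := massInv Λm Λp (massCoord Λm Λp a + s)
  -- Here `s` is the mass increment from `a` to `y`, so the linear bounds for `massCoord` exchange
  -- `(y - a) ^ 2` for `s ^ 2`.
  have l1 : g ^ 2 / 4 * (y - a) ^ 2 ≤ s ^ 2 := by
    have := pow_le_pow_left₀ (by positivity) hl.1 2
    rw [mul_pow, sq_abs, sq_abs] at this
    linarith
  have l2 : s ^ 2 ≤ 4 * g ^ 2 * (y - a) ^ 2 := by
    have := pow_le_pow_left₀ (abs_nonneg s) hl.2 2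
    rw [mul_pow, sq_abs, sq_abs] at this
    linarith
  constructor
  · refine le_trans ?_ hq.1
    calc D / (16 * g ^ 2) * s ^ 2 ≤ D / (16 * g ^ 2) * (4 * g ^ 2 * (y - a) ^ 2) := by gcongr
      _ = D / 4 * (y - a) ^ 2 := by field_simp; ring
  · refine hq.2.trans ?_
    calc D * (y - a) ^ 2 = 4 * D / g ^ 2 * (g ^ 2 / 4 * (y - a) ^ 2) := by field_simp
      _ ≤ 4 * D / g ^ 2 * s ^ 2 := by gcongr

end CharData

/-! ### The two-sided cubic form -/

theorem abs_le_of_cubic {c C s F : ℝ} (hc : 0 < c)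
    (h : (0 ≤ s → c / 3 * s ^ 3 ≤ F ∧ F ≤ C / 3 * s ^ 3) ∧
      (s ≤ 0 → C / 3 * s ^ 3 ≤ F ∧ F ≤ c / 3 * s ^ 3)) : |F| ≤ C / 3 * |s| ^ 3 := by
  rcases le_total 0 s with hs | hs
  · have := h.1 hs
    have h3 : 0 ≤ c / 3 * s ^ 3 := by positivity
    rw [abs_of_nonneg hs, abs_of_nonneg (h3.trans this.1)]
    exact this.2
  · have := h.2 hs
    have h3 : s ^ 3 ≤ 0 := by
      have := pow_nonneg (neg_nonneg.2 hs) 3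
      have e : (-s) ^ 3 = -s ^ 3 := by ring
      linarith
    have h4 : c / 3 * s ^ 3 ≤ 0 := mul_nonpos_of_nonneg_of_nonpos (by positivity) h3
    rw [abs_of_nonpos hs, abs_of_nonpos (this.2.trans h4)]
    have e : (-s) ^ 3 = -s ^ 3 := by ring
    rw [e]
    linarith [this.1]

/-- The increments `r`, `q` are controlled by `r - q` and by the cubic form. -/
theorem size_of_cubic {c C r q P Q : ℝ} (hc : 0 < c)
    (hP : (0 ≤ r → c / 3 * r ^ 3 ≤ P ∧ P ≤ C / 3 * r ^ 3) ∧
      (r ≤ 0 → C / 3 * r ^ 3 ≤ P ∧ P ≤ c / 3 * r ^ 3))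
    (hQ : (0 ≤ q → c / 3 * q ^ 3 ≤ Q ∧ Q ≤ C / 3 * q ^ 3) ∧
      (q ≤ 0 → C / 3 * q ^ 3 ≤ Q ∧ Q ≤ c / 3 * q ^ 3)) :
    |r| + |q| ≤ 4 * |r - q| ∨ c / 96 * (|r| + |q|) ^ 3 ≤ |P + Q| := by
  -- Opposite signs would give `|r - q| = |r| + |q|`. Outside the first alternative the signs
  -- therefore agree and the two cubic terms add without cancellation; `c / 96` is `c / 3` times the
  -- `1 / 32` of `hcube`.
  rcases le_or_gt (|r| + |q|) (4 * |r - q|) with hN | hN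
  · exact Or.inl hN
  right
  have hcube : ∀ x y : ℝ, 0 ≤ x → 0 ≤ y → |x - y| * 4 < x + y →
      1 / 32 * (x + y) ^ 3 ≤ x ^ 3 + y ^ 3 := fun x y hx hy _ => by
    nlinarith [mul_nonneg (add_nonneg hx hy) (sq_nonneg (x - y)), pow_nonneg (add_nonneg hx hy) 3]
  rcases le_total 0 r with hr | hr <;> rcases le_total 0 q with hq | hq
  · rw [abs_of_nonneg hr, abs_of_nonneg hq] at hN ⊢
    have h1 := (hP.1 hr).1
    have h2 := (hQ.1 hq).1
    have h3 := hcube r q hr hq (by linarith)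
    have : c / 96 * (r + q) ^ 3 ≤ P + Q := by nlinarith
    exact this.trans (le_abs_self _)
  · exfalso
    rw [abs_of_nonneg hr, abs_of_nonpos hq, abs_of_nonneg (by linarith)] at hN
    linarith
  · exfalso
    rw [abs_of_nonpos hr, abs_of_nonneg hq, abs_of_nonpos (by linarith)] at hN
    linarith
  · rw [abs_of_nonpos hr, abs_of_nonpos hq] at hN ⊢
    have h1 := (hP.2 hr).2
    have h2 := (hQ.2 hq).2
    have h3 := hcube (-r) (-q) (by linarith) (by linarith)
      (by rw [← neg_sub', abs_neg]; linarith)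
    have : c / 96 * (-r + -q) ^ 3 ≤ -(P + Q) := by nlinarith
    exact this.trans (neg_le_abs _)

theorem add_abs_pow_bounds (r q : ℝ) : (|r| + |q|) ^ 2 ≤ 2 * (r ^ 2 + q ^ 2) ∧
    r ^ 2 + q ^ 2 ≤ (|r| + |q|) ^ 2 ∧ |r| ^ 3 + |q| ^ 3 ≤ (|r| + |q|) ^ 3 := by
  rw [← sq_abs r, ← sq_abs q]
  have hr := abs_nonneg r
  have hq := abs_nonneg q
  refine ⟨by nlinarith [sq_nonneg (|r| - |q|)], by nlinarith, ?_⟩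
  have := mul_nonneg (mul_nonneg hr hq) (add_nonneg hr hq)
  have e : (|r| + |q|) ^ 3 = |r| ^ 3 + |q| ^ 3 + 3 * (|r| * |q| * (|r| + |q|)) := by ring
  linarith

theorem cubic_weaken {c C c' C' s F : ℝ} (hc : c' ≤ c) (hC : C ≤ C')
    (h : (0 ≤ s → c / 3 * s ^ 3 ≤ F ∧ F ≤ C / 3 * s ^ 3) ∧
      (s ≤ 0 → C / 3 * s ^ 3 ≤ F ∧ F ≤ c / 3 * s ^ 3)) :
    (0 ≤ s → c' / 3 * s ^ 3 ≤ F ∧ F ≤ C' / 3 * s ^ 3) ∧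
      (s ≤ 0 → C' / 3 * s ^ 3 ≤ F ∧ F ≤ c' / 3 * s ^ 3) := by
  refine ⟨fun hs => ⟨le_trans ?_ (h.1 hs).1, (h.1 hs).2.trans ?_⟩,
    fun hs => ⟨le_trans ?_ (h.2 hs).1, (h.2 hs).2.trans ?_⟩⟩
  · gcongr
  · gcongr
  · exact mul_le_mul_of_nonpos_right (by linarith) (Odd.pow_nonpos (by decide) hs)
  · exact mul_le_mul_of_nonpos_right (by linarith) (Odd.pow_nonpos (by decide) hs)

/-! ### Two-sided control near the singular point -/

/-- `N` measures the distance of `p` from the singular point in characteristic parameters. -/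
structure SingularScale (c C : ℝ) (Λm Λp : ℝ → ℝ) (p₀ p : ℝ × ℝ) (N : ℝ) : Prop where
  nonneg : 0 ≤ N
  gap_ge : c * N ^ 2 ≤ lamP Λm Λp p - lamM Λm Λp p
  velocity_le : |velocity Λm Λp p| ≤ C * N ^ 2
  time_le : |p.1 - p₀.1| ≤ N
  space_le : |p.2 - p₀.2| ≤ C * N ^ 3
  le_or_le : N ≤ 4 * |p.1 - p₀.1| ∨ c * N ^ 3 ≤ |p.2 - p₀.2|

namespace CharData

theorem charMap_sing_fst_pos (h : CharData Λm Λp α₀ β₀) : 0 < (charMap Λm Λp (α₀, β₀)).1 := by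
  rw [h.charMap_eq]
  exact sub_pos.2 (h.strictMono_massCoord h.sing_lt)

theorem tendsto_charParam_sing (h : CharData Λm Λp α₀ β₀) :
    Tendsto (charParam Λm Λp) (𝓝 (charMap Λm Λp (α₀, β₀))) (𝓝 (α₀, β₀)) := by
  have hmem : halfPlane ∈ 𝓝 (charMap Λm Λp (α₀, β₀)) :=
    mem_of_superset ((isOpen_lt continuous_const continuous_fst).mem_nhds h.charMap_sing_fst_pos)
      fun p (hp : 0 < p.1) => hp.le
  have := (h.continuousOn_charParam.continuousAt hmem).tendsto
  rwa [h.charParam_charMap h.sing_mem] at this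

/-- The scale is `N = |r| + |q|` for the mass increments `r` of `β` and `q` of `α`. The factor `1 /
96` comes from `size_of_cubic`; the gap alone would allow `c / 2`. -/
theorem eventually_singularScale (h : CharData Λm Λp α₀ β₀) {gα gβ Dα Dβ c C : ℝ}
    (hm : ContDiff ℝ 2 Λm) (hp : ContDiff ℝ 2 Λp) (hm0 : Λm α₀ = 0) (hp0 : Λp β₀ = 0)
    (hm1 : deriv Λm α₀ = 0) (hp1 : deriv Λp β₀ = 0)
    (hm2 : -deriv (deriv Λm) α₀ = Dα) (hp2 : deriv (deriv Λp) β₀ = Dβ)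
    (hDα : 0 < Dα) (hDβ : 0 < Dβ)
    (hgα : massDensity Λm Λp α₀ = gα) (hgβ : massDensity Λm Λp β₀ = gβ)
    (hc : 0 < c) (hcC : c ≤ C)
    (hcα : c ≤ Dα / (16 * gα ^ 2)) (hcβ : c ≤ Dβ / (16 * gβ ^ 2))
    (hCα : 4 * Dα / gα ^ 2 ≤ C) (hCβ : 4 * Dβ / gβ ^ 2 ≤ C) :
    ∀ᶠ p in 𝓝 (charMap Λm Λp (α₀, β₀)),
      ∃ N, SingularScale (c / 96) C Λm Λp (charMap Λm Λp (α₀, β₀)) p N := by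
  have hG0 : ∀ a, Tendsto (fun s => massCoord Λm Λp a + s) (𝓝 0) (𝓝 (massCoord Λm Λp a)) :=
    fun a => by
      simpa using (continuous_const.add continuous_id).tendsto (x := (0 : ℝ))
        (f := fun s => massCoord Λm Λp a + s)
  have Lp := h.quadratic_bounds_mass hp hp0 hp1 hp2 hDβ hgβ
  -- The sign change turns the maximum of `Λ₋` at `α₀` into a minimum.
  have Lm := h.quadratic_bounds_mass (f := fun x => -Λm x) hm.neg (by simp [hm0])
    (by simp [deriv.fun_neg, hm1]) (by simp only [deriv.fun_neg']; simpa [deriv.fun_neg] using hm2)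
    hDα hgα
  have Cp := cubic_bounds
    (F := fun s => posP Λm Λp (massInv Λm Λp (massCoord Λm Λp β₀ + s)) - posP Λm Λp β₀)
    (((hG0 β₀).eventually (h.range_massCoord_mem_nhds β₀)).mono fun s hs =>
      ((h.hasDerivAt_posP_massInv hs).comp_const_add (massCoord Λm Λp β₀) s).sub_const _) Lp
    (by simp [h.massInv_massCoord])
  have Cm := cubic_bounds
    (F := fun s => -(posM Λm Λp (massInv Λm Λp (massCoord Λm Λp α₀ + s)) - posM Λm Λp α₀))
    (((hG0 α₀).eventually (h.range_massCoord_mem_nhds α₀)).mono fun s hs =>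
      (((h.hasDerivAt_posM_massInv hs).comp_const_add (massCoord Λm Λp α₀) s).sub_const _).neg) Lm
    (by simp [h.massInv_massCoord])
  have hα : Tendsto (fun p => massCoord Λm Λp (charParam Λm Λp p).1 - massCoord Λm Λp α₀)
      (𝓝 (charMap Λm Λp (α₀, β₀))) (𝓝 0) := by
    have := ((h.continuous_massCoord.comp continuous_fst).tendsto (α₀, β₀)).comp
      h.tendsto_charParam_sing
    simpa [Function.comp_def] using this.sub_const (massCoord Λm Λp α₀)
  have hβ : Tendsto (fun p => massCoord Λm Λp (charParam Λm Λp p).2 - massCoord Λm Λp β₀)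
      (𝓝 (charMap Λm Λp (α₀, β₀))) (𝓝 0) := by
    have := ((h.continuous_massCoord.comp continuous_snd).tendsto (α₀, β₀)).comp
      h.tendsto_charParam_sing
    simpa [Function.comp_def] using this.sub_const (massCoord Λm Λp β₀)
  have hpos : ∀ᶠ p : ℝ × ℝ in 𝓝 (charMap Λm Λp (α₀, β₀)), 0 < p.1 :=
    (continuous_fst.tendsto _).eventually_const_lt h.charMap_sing_fst_pos
  filter_upwards [hβ.eventually Lp, hα.eventually Lm, hβ.eventually Cp, hα.eventually Cm, hpos]
    with p Lp Lm Cp Cm hp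
  have hpp := h.charMap_charParam (p := p) hp.le
  simp only [add_sub_cancel, h.massInv_massCoord] at Lp Lm Cp Cm
  have Cp := cubic_weaken hcβ hCβ Cp
  have Cm := cubic_weaken hcα hCα Cm
  have hT : p.1 - (charMap Λm Λp (α₀, β₀)).1 =
      (massCoord Λm Λp (charParam Λm Λp p).2 - massCoord Λm Λp β₀) -
      (massCoord Λm Λp (charParam Λm Λp p).1 - massCoord Λm Λp α₀) := by
    conv_lhs => rw [← hpp, h.charMap_eq, h.charMap_eq]
    ring
  have hX : p.2 - (charMap Λm Λp (α₀, β₀)).2 =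
      (posP Λm Λp (charParam Λm Λp p).2 - posP Λm Λp β₀) +
      -(posM Λm Λp (charParam Λm Λp p).1 - posM Λm Λp α₀) := by
    conv_lhs => rw [← hpp, h.charMap_eq, h.charMap_eq]
    ring
  set r := massCoord Λm Λp (charParam Λm Λp p).2 - massCoord Λm Λp β₀
  set q := massCoord Λm Λp (charParam Λm Λp p).1 - massCoord Λm Λp α₀
  have hC : 0 < C := hc.trans_le hcC
  have l1 : c * r ^ 2 ≤ lamP Λm Λp p :=
    (mul_le_mul_of_nonneg_right hcβ (sq_nonneg r)).trans Lp.1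
  have l2 : lamP Λm Λp p ≤ C * r ^ 2 :=
    Lp.2.trans (mul_le_mul_of_nonneg_right hCβ (sq_nonneg r))
  have l3 : c * q ^ 2 ≤ -lamM Λm Λp p :=
    (mul_le_mul_of_nonneg_right hcα (sq_nonneg q)).trans Lm.1
  have l4 : -lamM Λm Λp p ≤ C * q ^ 2 :=
    Lm.2.trans (mul_le_mul_of_nonneg_right hCα (sq_nonneg q))
  have n1 : 0 ≤ c * r ^ 2 := by positivity
  have n2 : 0 ≤ c * q ^ 2 := by positivity
  have hr := abs_nonneg r
  have hq := abs_nonneg q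
  obtain ⟨s1, s2, s3⟩ := add_abs_pow_bounds r q
  refine ⟨|r| + |q|, ⟨by positivity, ?_, ?_, ?_, ?_, ?_⟩⟩
  · have := mul_le_mul_of_nonneg_left s1 hc.le
    linarith
  · have := mul_le_mul_of_nonneg_left s2 hC.le
    rw [velocity, abs_le]
    constructor <;> linarith
  · rw [hT]
    exact abs_sub _ _
  · rw [hX]
    refine (abs_add_le _ _).trans ?_
    have := abs_le_of_cubic hc Cp
    have := abs_le_of_cubic hc Cm
    have := mul_le_mul_of_nonneg_left s3 hC.le
    have : 0 ≤ C * (|r| + |q|) ^ 3 := by positivity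
    linarith
  · rw [hT, hX]
    exact size_of_cubic hc Cp Cm

end CharData

/-! ### The estimates of density and velocity -/

namespace SingularScale

variable {c C N : ℝ} {p₀ p : ℝ × ℝ}

theorem scale_pos (hs : SingularScale c C Λm Λp p₀ p N) (hne : p ≠ p₀) : 0 < N := by
  refine lt_of_le_of_ne hs.nonneg fun h0 => hne ?_
  have h1 := hs.time_le
  have h2 := hs.space_le
  rw [← h0] at h1 h2
  have h2' : |p.2 - p₀.2| ≤ 0 := by simpa using h2
  exact Prod.ext (sub_eq_zero.1 (abs_nonpos_iff.1 h1)) (sub_eq_zero.1 (abs_nonpos_iff.1 h2'))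

theorem density_le (hs : SingularScale c C Λm Λp p₀ p N) {μ : ℝ} (hμ : 0 < μ)
    (hc : 0 < c) (hN : 0 < N) : density μ Λm Λp p ≤ ENNReal.ofReal (2 * μ / (c * N ^ 2)) := by
  have hpos : 0 < c * N ^ 2 := by positivity
  rw [density, ← ENNReal.ofReal_div_of_pos (hpos.trans_le hs.gap_ge)]
  exact ENNReal.ofReal_le_ofReal (div_le_div_of_nonneg_left (by positivity) hpos hs.gap_ge)

/-- The density is at most of order `N ^ (-2)`, and `N` is at least `|t - t₀|`. -/
theorem density_le_time (hs : SingularScale c C Λm Λp p₀ p N) {μ : ℝ} (hμ : 0 < μ)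
    (hc : 0 < c) (hne : p ≠ p₀) (ht : p.1 - p₀.1 ≠ 0) :
    density μ Λm Λp p ≤ ENNReal.ofReal (2 * μ / c * |p.1 - p₀.1| ^ (-2 : ℝ)) := by
  have hN := hs.scale_pos hne
  refine (hs.density_le hμ hc hN).trans (ENNReal.ofReal_le_ofReal ?_)
  have hT : 0 < |p.1 - p₀.1| := abs_pos.2 ht
  rw [Real.rpow_neg hT.le, Real.rpow_two, div_mul_eq_div_div, div_eq_mul_inv]
  have := pow_le_pow_left₀ hT.le hs.time_le 2
  gcongr

theorem sq_le_rpow {K X N : ℝ} (hN : 0 ≤ N) (hK : 0 ≤ K) (hX : 0 ≤ X) (h : N ^ 3 ≤ K * X) :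
    N ^ 2 ≤ K ^ (2 / 3 : ℝ) * X ^ (2 / 3 : ℝ) := by
  rw [← Real.mul_rpow hK hX]
  calc N ^ 2 = (N ^ 3) ^ (2 / 3 : ℝ) := by
        rw [← Real.rpow_natCast N 3, ← Real.rpow_mul hN, ← Real.rpow_natCast N 2]
        norm_num
    _ ≤ _ := Real.rpow_le_rpow (by positivity) h (by norm_num)

/-- Here the lower bound on `N` comes from `space_le`, which gives `N ^ 2 ≥ (|x - x₀| / C) ^ (2 /
3)`. -/
theorem density_le_space (hs : SingularScale c C Λm Λp p₀ p N) {μ : ℝ} (hμ : 0 < μ)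
    (hc : 0 < c) (hC : 0 < C) (hne : p ≠ p₀) (hx : p.2 - p₀.2 ≠ 0) :
    density μ Λm Λp p ≤
      ENNReal.ofReal (2 * μ / c * C ^ (2 / 3 : ℝ) * |p.2 - p₀.2| ^ (-(2 / 3) : ℝ)) := by
  have hN := hs.scale_pos hne
  refine (hs.density_le hμ hc hN).trans (ENNReal.ofReal_le_ofReal ?_)
  have hX : 0 < |p.2 - p₀.2| := abs_pos.2 hx
  have key : |p.2 - p₀.2| ^ (2 / 3 : ℝ) ≤ C ^ (2 / 3 : ℝ) * N ^ 2 := by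
    calc |p.2 - p₀.2| ^ (2 / 3 : ℝ) ≤ (C * N ^ 3) ^ (2 / 3 : ℝ) :=
          Real.rpow_le_rpow hX.le hs.space_le (by norm_num)
      _ = C ^ (2 / 3 : ℝ) * N ^ 2 := by
          rw [Real.mul_rpow hC.le (by positivity), ← Real.rpow_natCast N 3,
            ← Real.rpow_mul hN.le, ← Real.rpow_natCast N 2]
          norm_num
  rw [Real.rpow_neg hX.le, div_mul_eq_div_div, mul_assoc, div_eq_mul_inv (2 * μ / c)]
  have hXp : 0 < |p.2 - p₀.2| ^ (2 / 3 : ℝ) := by positivity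
  gcongr
  rw [← div_eq_mul_inv, inv_eq_one_div, div_le_div_iff₀ (by positivity) hXp]
  linarith

/-- The factor `c` in the hypothesis matches the one in `le_or_le`, so either alternative yields `N
≤ 4 |t - t₀|`, whence `16 = 4 ^ 2`. -/
theorem velocity_le_time (hs : SingularScale c C Λm Λp p₀ p N) (hc : 0 < c) (hC : 0 < C)
    (hx : |p.2 - p₀.2| ≤ c * |p.1 - p₀.1| ^ 3) :
    |velocity Λm Λp p| ≤ 16 * C * |p.1 - p₀.1| ^ (2 : ℝ) := by
  have hN : N ≤ 4 * |p.1 - p₀.1| := by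
    rcases hs.le_or_le with h | h
    · exact h
    · have h3 : N ^ 3 ≤ |p.1 - p₀.1| ^ 3 := le_of_mul_le_mul_left (h.trans hx) hc
      have := le_of_pow_le_pow_left₀ (by norm_num) (abs_nonneg _) h3
      linarith [abs_nonneg (p.1 - p₀.1)]
  rw [Real.rpow_two]
  refine hs.velocity_le.trans ?_
  calc C * N ^ 2 ≤ C * (4 * |p.1 - p₀.1|) ^ 2 := by
        have := hs.nonneg
        gcongr
    _ = _ := by ring

/-- Each alternative bounds `N ^ 3` by a multiple of `|x - x₀|`: `64 / e` with `64 = 4 ^ 3` in the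
first, `1 / c` in the second. The sum covers both. -/
theorem velocity_le_space (hs : SingularScale c C Λm Λp p₀ p N) {e : ℝ} (hc : 0 < c) (hC : 0 < C)
    (he : 0 < e) (hx : e * |p.1 - p₀.1| ^ 3 ≤ |p.2 - p₀.2|) :
    |velocity Λm Λp p| ≤ C * (64 / e + 1 / c) ^ (2 / 3 : ℝ) * |p.2 - p₀.2| ^ (2 / 3 : ℝ) := by
  have hX := abs_nonneg (p.2 - p₀.2)
  have hN : N ^ 3 ≤ (64 / e + 1 / c) * |p.2 - p₀.2| := by
    rcases hs.le_or_le with h | h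
    · have h3 := pow_le_pow_left₀ hs.nonneg h 3
      have h4 : |p.1 - p₀.1| ^ 3 ≤ |p.2 - p₀.2| / e := by
        rw [le_div_iff₀ he]
        linarith
      have h5 : 0 ≤ 1 / c * |p.2 - p₀.2| := by positivity
      calc N ^ 3 ≤ 64 * |p.1 - p₀.1| ^ 3 := by linarith
        _ ≤ 64 * (|p.2 - p₀.2| / e) := by gcongr
        _ ≤ 64 * (|p.2 - p₀.2| / e) + 1 / c * |p.2 - p₀.2| := le_add_of_nonneg_right h5
        _ = _ := by ring
    · have h4 : N ^ 3 ≤ |p.2 - p₀.2| / c := by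
        rw [le_div_iff₀ hc]
        linarith
      have h5 : 0 ≤ 64 / e * |p.2 - p₀.2| := by positivity
      calc N ^ 3 ≤ |p.2 - p₀.2| / c := h4
        _ ≤ 64 / e * |p.2 - p₀.2| + |p.2 - p₀.2| / c := le_add_of_nonneg_left h5
        _ = _ := by ring
  refine hs.velocity_le.trans ?_
  rw [mul_assoc]
  exact mul_le_mul_of_nonneg_left (sq_le_rpow hs.nonneg (by positivity) hX hN) hC.le

end SingularScale

/-! ### Integration over the parameter set -/

theorem isClosed_paramSet : IsClosed paramSet := isClosed_le continuous_fst continuous_snd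

theorem measurableSet_paramSet : MeasurableSet paramSet := isClosed_paramSet.measurableSet

theorem integrableOn_paramSet {V : ℝ × ℝ → ℝ} {N : ℝ} (hV : Continuous V)
    (hN : ∀ q ∈ paramSet, ¬ (|q.1| ≤ N ∧ |q.2| ≤ N) → V q = 0) : IntegrableOn V paramSet := by
  refine IntegrableOn.of_forall_sdiff_eq_zero
    (hV.continuousOn.integrableOn_compact (isCompact_Icc.prod isCompact_Icc :
      IsCompact (Icc (-N) N ×ˢ Icc (-N) N))) measurableSet_paramSet ?_
  rintro q ⟨hq, hq'⟩
  exact hN q hq fun hh => hq' ⟨abs_le.1 hh.1, abs_le.1 hh.2⟩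

/-- Fubini with `β` innermost: the integral over `[a, ∞)` leaves only the value at the diagonal.
Vanishing is required on `paramSet` alone, where `bdd_param` provides it. -/
theorem integral_paramSet_snd {w : ℝ → ℝ} {F F' : ℝ × ℝ → ℝ} {N : ℝ} (hw : Continuous w)
    (hF' : Continuous F') (hd : ∀ a b, HasDerivAt (fun b => F (a, b)) (F' (a, b)) b)
    (hN : ∀ q ∈ paramSet, ¬ (|q.1| ≤ N ∧ |q.2| ≤ N) → F q = 0)
    (hN' : ∀ q ∈ paramSet, ¬ (|q.1| ≤ N ∧ |q.2| ≤ N) → F' q = 0) :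
    IntegrableOn (fun q => w q.1 * F' q) paramSet ∧
      ∫ q in paramSet, w q.1 * F' q = -∫ a, w a * F (a, a) := by
  have hint : IntegrableOn (fun q => w q.1 * F' q) paramSet :=
    integrableOn_paramSet (N := N) ((hw.comp continuous_fst).mul hF') fun q hq hh => by
      rw [hN' q hq hh, mul_zero]
  refine ⟨hint, ?_⟩
  rw [← integral_indicator measurableSet_paramSet, Measure.volume_eq_prod, integral_prod,
    ← integral_neg]
  swap
  · exact (integrable_indicator_iff measurableSet_paramSet).2 hint
  congr 1
  ext a
  have h1 : ∀ b, paramSet.indicator (fun q : ℝ × ℝ => w q.1 * F' q) (a, b) =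
      (Ici a).indicator (fun b => w a * F' (a, b)) b := fun b => by
    by_cases hab : a ≤ b
    · rw [indicator_of_mem (show (a, b) ∈ paramSet from hab), indicator_of_mem (mem_Ici.2 hab)]
    · rw [indicator_of_notMem (show (a, b) ∉ paramSet from hab),
        indicator_of_notMem (fun hh => hab (mem_Ici.1 hh))]
  simp only [h1]
  rw [integral_indicator measurableSet_Ici, integral_Ici_eq_integral_Ioi, integral_const_mul,
    integral_Ioi_of_hasDerivAt_of_tendsto (f := fun b => F (a, b)) (m := 0)
      (hd a a).continuousAt.continuousWithinAt (fun b _ => hd a b)]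
  · ring
  · refine IntegrableOn.of_forall_sdiff_eq_zero
      ((hF'.comp (Continuous.prodMk_right a)).continuousOn.integrableOn_Icc (a := a) (b := N))
      measurableSet_Ioi ?_
    rintro b ⟨hb, hb'⟩
    exact hN' (a, b) (show a ≤ b from le_of_lt hb) fun hh => hb' ⟨le_of_lt hb, (le_abs_self b).trans hh.2⟩
  · refine tendsto_const_nhds.congr' ?_
    filter_upwards [eventually_ge_atTop a, eventually_gt_atTop N] with b hb hb'
    exact (hN (a, b) hb fun hh => absurd ((le_abs_self b).trans hh.2) (not_le.2 hb')).symm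

theorem integral_paramSet_fst {w : ℝ → ℝ} {F F' : ℝ × ℝ → ℝ} {N : ℝ} (hw : Continuous w)
    (hF' : Continuous F') (hd : ∀ a b, HasDerivAt (fun a => F (a, b)) (F' (a, b)) a)
    (hN : ∀ q ∈ paramSet, ¬ (|q.1| ≤ N ∧ |q.2| ≤ N) → F q = 0)
    (hN' : ∀ q ∈ paramSet, ¬ (|q.1| ≤ N ∧ |q.2| ≤ N) → F' q = 0) :
    IntegrableOn (fun q => w q.2 * F' q) paramSet ∧
      ∫ q in paramSet, w q.2 * F' q = ∫ b, w b * F (b, b) := by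
  have hint : IntegrableOn (fun q => w q.2 * F' q) paramSet :=
    integrableOn_paramSet (N := N) ((hw.comp continuous_snd).mul hF') fun q hq hh => by
      rw [hN' q hq hh, mul_zero]
  refine ⟨hint, ?_⟩
  rw [← integral_indicator measurableSet_paramSet, Measure.volume_eq_prod, integral_prod_symm]
  swap
  · exact (integrable_indicator_iff measurableSet_paramSet).2 hint
  congr 1
  ext b
  have h1 : ∀ a, paramSet.indicator (fun q : ℝ × ℝ => w q.2 * F' q) (a, b) =
      (Iic b).indicator (fun a => w b * F' (a, b)) a := fun a => by
    by_cases hab : a ≤ b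
    · rw [indicator_of_mem (show (a, b) ∈ paramSet from hab), indicator_of_mem (mem_Iic.2 hab)]
    · rw [indicator_of_notMem (show (a, b) ∉ paramSet from hab),
        indicator_of_notMem (fun hh => hab (mem_Iic.1 hh))]
  simp only [h1]
  rw [integral_indicator measurableSet_Iic, integral_const_mul,
    integral_Iic_of_hasDerivAt_of_tendsto (f := fun a => F (a, b)) (m := 0)
      (hd b b).continuousAt.continuousWithinAt (fun a _ => hd a b)]
  · ring
  · refine IntegrableOn.of_forall_sdiff_eq_zero
      ((hF'.comp (Continuous.prodMk_left b)).continuousOn.integrableOn_Icc (a := -N) (b := b))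
      measurableSet_Iic ?_
    rintro a ⟨ha, ha'⟩
    exact hN' (a, b) ha fun hh => ha' ⟨(abs_le.1 hh.1).1, ha⟩
  · refine tendsto_const_nhds.congr' ?_
    filter_upwards [eventually_le_atBot b, eventually_lt_atBot (-N)] with a ha ha'
    exact (hN (a, b) ha fun hh => absurd (abs_le.1 hh.1).1 (not_le.2 ha')).symm

/-! ### The weak equations in characteristic parameters -/

theorem clm_apply_prod (L : ℝ × ℝ →L[ℝ] ℝ) (x y : ℝ) : L (x, y) = x * L (1, 0) + y * L (0, 1) := by
  have : ((x, y) : ℝ × ℝ) = x • (1, 0) + y • (0, 1) := by simp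
  rw [this, map_add, map_smul, map_smul, smul_eq_mul, smul_eq_mul]

theorem charDeriv_inl (q : ℝ × ℝ) : charDeriv Λm Λp q (1, 0) =
    (-massDensity Λm Λp q.1, -(Λm q.1 * massDensity Λm Λp q.1)) := by
  simp [charDeriv]

theorem charDeriv_inr (q : ℝ × ℝ) : charDeriv Λm Λp q (0, 1) =
    (massDensity Λm Λp q.2, Λp q.2 * massDensity Λm Λp q.2) := by
  simp [charDeriv]

namespace CharData

theorem abs_det_charDeriv (h : CharData Λm Λp α₀ β₀) {q : ℝ × ℝ} (hq : q ∈ paramSet)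
    (hne : q ≠ (α₀, β₀)) : |(charDeriv Λm Λp q).det| =
      massDensity Λm Λp q.1 * massDensity Λm Λp q.2 * (Λp q.2 - Λm q.1) := by
  rw [det_charDeriv, abs_neg, abs_of_pos]
  exact mul_pos (mul_pos (h.massDensity_pos _) (h.massDensity_pos _))
    (sub_pos.2 (h.gap _ _ hq hne))

/-- A pair of fields whose pull-backs, times the Jacobian, have the divergence form given by
`w₁(α)` and `w₂(β)` satisfies the corresponding weak balance law. -/
theorem weak_balance (h : CharData Λm Λp α₀ β₀) {φ Wt Wx : ℝ × ℝ → ℝ} {w₁ w₂ : ℝ → ℝ}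
    (hφ : ContDiff ℝ 1 φ) (hφc : HasCompactSupport φ) (hw₁ : Continuous w₁) (hw₂ : Continuous w₂)
    (hWt : ∀ q ∈ paramSet, q ≠ (α₀, β₀) →
      massDensity Λm Λp q.1 * massDensity Λm Λp q.2 * (Λp q.2 - Λm q.1) * Wt (charMap Λm Λp q) =
        w₁ q.1 * massDensity Λm Λp q.2 - w₂ q.2 * massDensity Λm Λp q.1)
    (hWx : ∀ q ∈ paramSet, q ≠ (α₀, β₀) →
      massDensity Λm Λp q.1 * massDensity Λm Λp q.2 * (Λp q.2 - Λm q.1) * Wx (charMap Λm Λp q) =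
        w₁ q.1 * (Λp q.2 * massDensity Λm Λp q.2) - w₂ q.2 * (Λm q.1 * massDensity Λm Λp q.1)) :
    IntegrableOn (fun p => Wt p * fderiv ℝ φ p (1, 0)) halfPlane ∧
    IntegrableOn (fun p => Wx p * fderiv ℝ φ p (0, 1)) halfPlane ∧
    ∫ p in halfPlane, (Wt p * fderiv ℝ φ p (1, 0) + Wx p * fderiv ℝ φ p (0, 1)) =
      -∫ x, (w₁ x - w₂ x) * φ (0, x) := by
  obtain ⟨R, hR⟩ : ∃ R, ∀ p ∈ tsupport φ, |p.1| ≤ R ∧ |p.2| ≤ R := by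
    obtain ⟨R, hR⟩ := hφc.isCompact.isBounded.exists_norm_le
    exact ⟨R, fun p hp => ⟨(norm_fst_le p).trans (hR p hp), (norm_snd_le p).trans (hR p hp)⟩⟩
  -- By properness, the pull-back of the test function vanishes on `paramSet` outside a bounded box.
  obtain ⟨N, hN⟩ := h.bdd_param R
  have hout : ∀ q ∈ paramSet, ¬ (|q.1| ≤ N ∧ |q.2| ≤ N) → charMap Λm Λp q ∉ tsupport φ :=
    fun q hq hh hs => hh (hN q hq (hR _ hs).1 (hR _ hs).2)
  have hv0 : ∀ q ∈ paramSet, ¬ (|q.1| ≤ N ∧ |q.2| ≤ N) → φ (charMap Λm Λp q) = 0 :=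
    fun q hq hh => image_eq_zero_of_notMem_tsupport (hout q hq hh)
  have hv1 : ∀ q ∈ paramSet, ¬ (|q.1| ≤ N ∧ |q.2| ≤ N) → fderiv ℝ φ (charMap Λm Λp q) = 0 :=
    fun q hq hh => fderiv_of_notMem_tsupport ℝ (hout q hq hh)
  have hcd : Continuous (fun q => fderiv ℝ φ (charMap Λm Λp q)) :=
    (hφ.continuous_fderiv one_ne_zero).comp h.continuous_charMap
  have hcv : ∀ v : ℝ × ℝ, Continuous (fun q => fderiv ℝ φ (charMap Λm Λp q) v) := fun v =>
    hcd.clm_apply continuous_const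
  have hg := h.continuous_massDensity
  have hg1 : Continuous (fun q : ℝ × ℝ => massDensity Λm Λp q.1) := hg.comp continuous_fst
  have hg2 : Continuous (fun q : ℝ × ℝ => massDensity Λm Λp q.2) := hg.comp continuous_snd
  have hm1 : Continuous (fun q : ℝ × ℝ => Λm q.1) := h.cont_m.comp continuous_fst
  have hp2 : Continuous (fun q : ℝ × ℝ => Λp q.2) := h.cont_p.comp continuous_snd
  have hw1 : Continuous (fun q : ℝ × ℝ => w₁ q.1) := hw₁.comp continuous_fst
  have hw2 : Continuous (fun q : ℝ × ℝ => w₂ q.2) := hw₂.comp continuous_snd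
  have hchain : ∀ q, HasFDerivAt (fun q => φ (charMap Λm Λp q))
      ((fderiv ℝ φ (charMap Λm Λp q)).comp (charDeriv Λm Λp q)) q := fun q =>
    (hφ.differentiable one_ne_zero _).hasFDerivAt.comp q (h.hasFDerivAt_charMap q)
  obtain ⟨i₂, e₂⟩ := integral_paramSet_snd (w := w₁) (F := fun q => φ (charMap Λm Λp q))
    (F' := fun q => fderiv ℝ φ (charMap Λm Λp q) (massDensity Λm Λp q.2,
      Λp q.2 * massDensity Λm Λp q.2)) (N := N) hw₁ (hcd.clm_apply (hg2.prodMk (hp2.mul hg2)))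
    (fun a b => by
      have := (hchain (a, b)).comp_hasDerivAt b ((hasDerivAt_const b a).prodMk (hasDerivAt_id b))
      rwa [ContinuousLinearMap.comp_apply, charDeriv_inr] at this)
    hv0 (fun q hq hh => by rw [hv1 q hq hh]; rfl)
  obtain ⟨i₁, e₁⟩ := integral_paramSet_fst (w := w₂) (F := fun q => φ (charMap Λm Λp q))
    (F' := fun q => fderiv ℝ φ (charMap Λm Λp q) (-massDensity Λm Λp q.1,
      -(Λm q.1 * massDensity Λm Λp q.1))) (N := N) hw₂
    (hcd.clm_apply (hg1.neg.prodMk (hm1.mul hg1).neg))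
    (fun a b => by
      have := (hchain (a, b)).comp_hasDerivAt a ((hasDerivAt_id a).prodMk (hasDerivAt_const a b))
      rwa [ContinuousLinearMap.comp_apply, charDeriv_inl] at this)
    hv0 (fun q hq hh => by rw [hv1 q hq hh]; rfl)
  have hae : ∀ᵐ q : ℝ × ℝ, q ≠ (α₀, β₀) := by
    rw [ae_iff]
    simp
  have himg : charMap Λm Λp '' paramSet = halfPlane := h.bijOn_charMap.image_eq
  have hdet : ∀ q ∈ paramSet, HasFDerivWithinAt (charMap Λm Λp) (charDeriv Λm Λp q) paramSet q :=
    fun q _ => (h.hasFDerivAt_charMap q).hasFDerivWithinAt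
  have hT : ∀ q ∈ paramSet, q ≠ (α₀, β₀) → ∀ y,
      |(charDeriv Λm Λp q).det| * (Wt (charMap Λm Λp q) * y) =
        (w₁ q.1 * massDensity Λm Λp q.2 - w₂ q.2 * massDensity Λm Λp q.1) * y :=
    fun q hq hne y => by rw [h.abs_det_charDeriv hq hne, ← mul_assoc, hWt q hq hne]
  have hX : ∀ q ∈ paramSet, q ≠ (α₀, β₀) → ∀ y,
      |(charDeriv Λm Λp q).det| * (Wx (charMap Λm Λp q) * y) =
        (w₁ q.1 * (Λp q.2 * massDensity Λm Λp q.2) -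
          w₂ q.2 * (Λm q.1 * massDensity Λm Λp q.1)) * y :=
    fun q hq hne y => by rw [h.abs_det_charDeriv hq hne, ← mul_assoc, hWx q hq hne]
  refine ⟨?_, ?_, ?_⟩
  · rw [← himg, integrableOn_image_iff_integrableOn_abs_det_fderiv_smul volume
      measurableSet_paramSet hdet h.injOn_charMap]
    -- Off the singular parameter, a null set, the integrand times the Jacobian is a continuous
    -- function; the blow-up of `Wt` does no harm.
    refine Integrable.congr (integrableOn_paramSet (N := N)
      (((hw1.mul hg2).sub (hw2.mul hg1)).mul (hcv (1, 0)))
      fun q hq hh => by simp [hv1 q hq hh]) ?_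
    filter_upwards [ae_restrict_mem measurableSet_paramSet, ae_restrict_of_ae hae] with q hq hne
    exact (hT q hq hne _).symm
  · rw [← himg, integrableOn_image_iff_integrableOn_abs_det_fderiv_smul volume
      measurableSet_paramSet hdet h.injOn_charMap]
    refine Integrable.congr (integrableOn_paramSet (N := N)
      (((hw1.mul (hp2.mul hg2)).sub (hw2.mul (hm1.mul hg1))).mul (hcv (0, 1)))
      fun q hq hh => by simp [hv1 q hq hh]) ?_
    filter_upwards [ae_restrict_mem measurableSet_paramSet, ae_restrict_of_ae hae] with q hq hne
    exact (hX q hq hne _).symm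
  · rw [← himg, integral_image_eq_integral_abs_det_fderiv_smul volume
      measurableSet_paramSet hdet h.injOn_charMap]
    have hsum : ∫ q in paramSet, |(charDeriv Λm Λp q).det| •
        (Wt (charMap Λm Λp q) * fderiv ℝ φ (charMap Λm Λp q) (1, 0) +
          Wx (charMap Λm Λp q) * fderiv ℝ φ (charMap Λm Λp q) (0, 1)) =
        ∫ q in paramSet, (w₁ q.1 * fderiv ℝ φ (charMap Λm Λp q) (massDensity Λm Λp q.2,
          Λp q.2 * massDensity Λm Λp q.2) + w₂ q.2 * fderiv ℝ φ (charMap Λm Λp q)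
          (-massDensity Λm Λp q.1, -(Λm q.1 * massDensity Λm Λp q.1))) := by
      refine integral_congr_ae ?_
      filter_upwards [ae_restrict_mem measurableSet_paramSet, ae_restrict_of_ae hae] with q hq hne
      rw [smul_eq_mul, mul_add, hT q hq hne, hX q hq hne, clm_apply_prod _ (massDensity Λm Λp q.2),
        clm_apply_prod _ (-massDensity Λm Λp q.1)]
      ring
    rw [hsum, integral_add i₂ i₁, e₁, e₂]
    -- The diagonal corresponds to the initial line, which turns the boundary terms into the initial
    -- data.
    simp only [charMap_diag]
    have hc0 : Continuous fun x : ℝ => φ (0, x) := hφ.continuous.comp (Continuous.prodMk_right 0)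
    have hs0 : HasCompactSupport fun x : ℝ => φ (0, x) := by
      refine HasCompactSupport.of_support_subset_isCompact (isCompact_Icc (a := -R) (b := R)) ?_
      intro x hx
      exact abs_le.1 (hR _ (subset_tsupport φ hx)).2
    have j₁ : Integrable fun x => w₁ x * φ (0, x) :=
      (hw₁.mul hc0).integrable_of_hasCompactSupport hs0.mul_left
    have j₂ : Integrable fun x => w₂ x * φ (0, x) :=
      (hw₂.mul hc0).integrable_of_hasCompactSupport hs0.mul_left
    simp only [sub_mul]
    rw [integral_sub j₁ j₂]
    ring

end CharData

/-! ### The Delta-like solution -/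

theorem toReal_density {μ : ℝ} (hμ : 0 < μ) {p : ℝ × ℝ}
    (hp : lamM Λm Λp p ≤ lamP Λm Λp p) :
    (density μ Λm Λp p).toReal = 2 * μ / (lamP Λm Λp p - lamM Λm Λp p) := by
  rw [density, ENNReal.toReal_div, ENNReal.toReal_ofReal (by positivity),
    ENNReal.toReal_ofReal (sub_nonneg.2 hp)]

namespace CharData

theorem lamM_lt_lamP (h : CharData Λm Λp α₀ β₀) {p : ℝ × ℝ} (hp : p ∈ halfPlane)
    (hne : p ≠ charMap Λm Λp (α₀, β₀)) : lamM Λm Λp p < lamP Λm Λp p :=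
  h.gap _ _ (h.charParam_mem hp) fun e => hne (by
    rw [← h.charMap_charParam hp, ← e])

theorem lamM_sing (h : CharData Λm Λp α₀ β₀) :
    lamM Λm Λp (charMap Λm Λp (α₀, β₀)) = lamP Λm Λp (charMap Λm Λp (α₀, β₀)) := by
  rw [lamM, lamP, h.charParam_charMap h.sing_mem]
  exact h.sing_eq

theorem lamM_le_lamP (h : CharData Λm Λp α₀ β₀) {p : ℝ × ℝ} (hp : p ∈ halfPlane) :
    lamM Λm Λp p ≤ lamP Λm Λp p := by
  by_cases hne : p = charMap Λm Λp (α₀, β₀)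
  · rw [hne, h.lamM_sing]
  · exact (h.lamM_lt_lamP hp hne).le

theorem sing_mem_halfPlane (h : CharData Λm Λp α₀ β₀) :
    charMap Λm Λp (α₀, β₀) ∈ halfPlane := h.mapsTo_charMap h.sing_mem

theorem measurable_conserved (h : CharData Λm Λp α₀ β₀) (μ : ℝ) :
    Measurable (halfPlane.domRestrict fun p : ℝ × ℝ =>
      ![(density μ Λm Λp p).toReal, (density μ Λm Λp p).toReal * velocity Λm Λp p]) := by
  have hm : Measurable (halfPlane.domRestrict (lamM Λm Λp)) :=
    (continuousOn_iff_continuous_domRestrict.1 h.continuousOn_lamM).measurable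
  have hp : Measurable (halfPlane.domRestrict (lamP Λm Λp)) :=
    (continuousOn_iff_continuous_domRestrict.1 h.continuousOn_lamP).measurable
  have hd : Measurable (fun p : halfPlane => (density μ Λm Λp p).toReal) :=
    (measurable_const.div (hp.sub hm).ennreal_ofReal).ennreal_toReal
  have hv : Measurable (fun p : halfPlane => velocity Λm Λp p) := (hp.add hm).div_const 2
  refine measurable_pi_iff.2 fun i => ?_
  fin_cases i
  · exact hd
  · exact hd.mul hv

theorem isWeakSolution (h : CharData Λm Λp α₀ β₀) {μ p₀ : ℝ} (hμ : 0 < μ) {ρ₀ u₀ : ℝ → ℝ}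
    (hρ₀ : Continuous ρ₀) (hu₀ : Continuous u₀) (hρ₀b : ∃ M : ℝ, ∀ x, |ρ₀ x| ≤ M)
    (hu₀b : ∃ M : ℝ, ∀ x, |u₀ x| ≤ M)
    (hρ : ∀ x, ρ₀ x = 2 * μ * massDensity Λm Λp x) (hu : ∀ x, Λp x + Λm x = 2 * u₀ x) :
    IsWeakSolution (flux μ p₀) (fun x => ![ρ₀ x, ρ₀ x * u₀ x])
      (fun p => ![(density μ Λm Λp p).toReal,
        (density μ Λm Λp p).toReal * velocity Λm Λp p]) := by
  have hg := h.continuous_massDensity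
  have hval : ∀ q ∈ paramSet, (density μ Λm Λp (charMap Λm Λp q)).toReal =
      2 * μ / (Λp q.2 - Λm q.1) ∧
      velocity Λm Λp (charMap Λm Λp q) = (Λp q.2 + Λm q.1) / 2 := fun q hq => by
    rw [toReal_density hμ (h.lamM_le_lamP (h.mapsTo_charMap hq)), velocity, lamM, lamP,
      h.charParam_charMap hq]
    exact ⟨rfl, rfl⟩
  have mass := fun (φ : ℝ × ℝ → ℝ) (hφ : ContDiff ℝ 1 φ) (hφc : HasCompactSupport φ) =>
    h.weak_balance hφ hφc (Wt := fun p => (density μ Λm Λp p).toReal)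
      (Wx := fun p => (density μ Λm Λp p).toReal * velocity Λm Λp p)
      -- The Jacobian times `ρ` is `2 μ` times the product of the two mass densities, split evenly
      -- between `w₁` and `-w₂`; on the diagonal `w₁ - w₂ = ρ₀`.
      (w₁ := fun a => μ * massDensity Λm Λp a) (w₂ := fun b => -(μ * massDensity Λm Λp b))
      (continuous_const.mul hg) (continuous_const.mul hg).neg
      (fun q hq hne => by
        have := (sub_pos.2 (h.gap _ _ hq hne)).ne'
        simp only [(hval q hq).1]
        field_simp
        ring)
      (fun q hq hne => by
        have := (sub_pos.2 (h.gap _ _ hq hne)).ne'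
        simp only [(hval q hq).1, (hval q hq).2]
        field_simp
        ring)
  have momentum := fun (φ : ℝ × ℝ → ℝ) (hφ : ContDiff ℝ 1 φ) (hφc : HasCompactSupport φ) =>
    h.weak_balance hφ hφc (Wt := fun p => (density μ Λm Λp p).toReal * velocity Λm Λp p)
      (Wx := fun p => ((density μ Λm Λp p).toReal * velocity Λm Λp p) ^ 2 /
        (density μ Λm Λp p).toReal + pressure μ p₀ (density μ Λm Λp p).toReal)
      -- This rests on `ρ u² + p = ρ λ₊ λ₋ + p₀`. The constant `p₀` enters both weights and cancels
      -- in `w₁ - w₂ = ρ₀ u₀`.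
      (w₁ := fun a => (μ * Λm a + p₀) * massDensity Λm Λp a)
      (w₂ := fun b => (-(μ * Λp b) + p₀) * massDensity Λm Λp b)
      (((continuous_const.mul h.cont_m).add continuous_const).mul hg)
      (((continuous_const.mul h.cont_p).neg.add continuous_const).mul hg)
      (fun q hq hne => by
        have := (sub_pos.2 (h.gap _ _ hq hne)).ne'
        simp only [(hval q hq).1, (hval q hq).2]
        field_simp
        ring)
      (fun q hq hne => by
        have := (sub_pos.2 (h.gap _ _ hq hne)).ne'
        have := hμ.ne'
        simp only [(hval q hq).1, (hval q hq).2, pressure]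
        field_simp
        ring)
  refine ⟨?_, ?_, h.measurable_conserved μ, ?_, ?_, ?_⟩
  · refine measurable_pi_iff.2 fun i => ?_
    fin_cases i
    · exact hρ₀.measurable
    · exact (hρ₀.mul hu₀).measurable
  · obtain ⟨M, hM⟩ := hρ₀b
    obtain ⟨M', hM'⟩ := hu₀b
    refine ⟨max M (M * M'), fun x i => ?_⟩
    fin_cases i
    · exact (hM x).trans (le_max_left _ _)
    · refine le_trans ?_ (le_max_right _ _)
      change |ρ₀ x * u₀ x| ≤ _
      rw [abs_mul]
      exact mul_le_mul (hM x) (hM' x) (abs_nonneg _) ((abs_nonneg _).trans (hM x))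
  · intro φ hφ hφc i
    fin_cases i
    · exact (mass φ hφ hφc).1
    · exact (momentum φ hφ hφc).1
  · intro φ hφ hφc i
    fin_cases i
    · exact (mass φ hφ hφc).2.1
    · exact (momentum φ hφ hφc).2.1
  · intro φ hφ hφc i
    fin_cases i
    · have e := (mass φ hφ hφc).2.2
      have e' : ∀ x, (μ * massDensity Λm Λp x - -(μ * massDensity Λm Λp x)) * φ (0, x) =
          ρ₀ x * φ (0, x) := fun x => by rw [hρ]; ring
      simp only [e'] at e
      rw [← eq_neg_iff_add_eq_zero]
      exact e
    · have e := (momentum φ hφ hφc).2.2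
      have e' : ∀ x, ((μ * Λm x + p₀) * massDensity Λm Λp x -
          (-(μ * Λp x) + p₀) * massDensity Λm Λp x) * φ (0, x) =
          ρ₀ x * u₀ x * φ (0, x) := fun x => by
        rw [hρ]
        linear_combination μ * massDensity Λm Λp x * φ (0, x) * hu x
      simp only [e'] at e
      rw [← eq_neg_iff_add_eq_zero]
      exact e

theorem isDeltaLikeSolution (h : CharData Λm Λp α₀ β₀) {k : ℕ∞} (hk : k ≠ 0) {μ p₀ : ℝ}
    (hμ : 0 < μ) {ρ₀ u₀ : ℝ → ℝ} (hm : ContDiff ℝ k Λm) (hp : ContDiff ℝ k Λp)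
    (hW : IsWeakSolution (flux μ p₀) (fun x => ![ρ₀ x, ρ₀ x * u₀ x])
      (fun p => ![(density μ Λm Λp p).toReal,
        (density μ Λm Λp p).toReal * velocity Λm Λp p])) :
    IsDeltaLikeSolution k μ p₀ ρ₀ u₀ (density μ Λm Λp) (velocity Λm Λp)
      {charMap Λm Λp (α₀, β₀)} := by
  have hμ2 : 0 < 2 * μ := by positivity
  have hμ' : ENNReal.ofReal (2 * μ) ≠ 0 := (ENNReal.ofReal_pos.2 hμ2).ne'
  have hsm : ContDiffOn ℝ k (charParam Λm Λp) (halfPlane \ {charMap Λm Λp (α₀, β₀)}) :=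
    fun p hpm => (h.contDiffWithinAt_charParam hk hm hp hpm.1 hpm.2).mono sdiff_subset
  have hlm : ContDiffOn ℝ k (lamM Λm Λp) (halfPlane \ {charMap Λm Λp (α₀, β₀)}) :=
    hm.comp_contDiffOn hsm.fst
  have hlp : ContDiffOn ℝ k (lamP Λm Λp) (halfPlane \ {charMap Λm Λp (α₀, β₀)}) :=
    hp.comp_contDiffOn hsm.snd
  refine ⟨?_, ?_, ?_, ?_, ?_, ?_, ?_, ?_, hW⟩
  · exact singleton_subset_iff.2 h.sing_mem_halfPlane
  · simp
  · rintro p rfl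
    rw [density, h.lamM_sing, sub_self, ENNReal.ofReal_zero, ENNReal.div_zero hμ']
  · rintro p rfl
    have h1 : Tendsto (fun p => lamP Λm Λp p - lamM Λm Λp p)
        (𝓝[halfPlane \ {charMap Λm Λp (α₀, β₀)}] charMap Λm Λp (α₀, β₀)) (𝓝 0) := by
      have := (h.continuousOn_lamP.sub h.continuousOn_lamM) _ h.sing_mem_halfPlane
      have := this.mono (sdiff_subset (t := {charMap Λm Λp (α₀, β₀)}))
      rw [ContinuousWithinAt, Pi.sub_apply, h.lamM_sing, sub_self] at this
      exact this
    have h2 := ENNReal.Tendsto.const_div (a := ENNReal.ofReal (2 * μ))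
      (ENNReal.tendsto_ofReal h1) (Or.inr ENNReal.ofReal_ne_top)
    rwa [ENNReal.ofReal_zero, ENNReal.div_zero hμ'] at h2
  · intro p hpm
    exact ENNReal.div_ne_top ENNReal.ofReal_ne_top
      (ENNReal.ofReal_pos.2 (sub_pos.2 (h.lamM_lt_lamP hpm.1 hpm.2))).ne'
  · intro p hpm
    exact ENNReal.div_pos hμ' ENNReal.ofReal_ne_top
  · refine ((contDiffOn_const (c := 2 * μ)).div (hlp.sub hlm) fun p hpm =>
      (sub_pos.2 (h.lamM_lt_lamP hpm.1 hpm.2)).ne').congr fun p hpm => ?_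
    exact toReal_density hμ (h.lamM_le_lamP hpm.1)
  · exact (hlp.add hlm).div_const 2

end CharData

/-! ### Reduction of the gas dynamics data -/

/-- Positivity of the initial density is a consequence of `Λ₋ < Λ₊`; vacuum is excluded too, as `μ /
0 = 0`. -/
theorem density_pos_of_lam_lt {μ : ℝ} (hμ : 0 < μ) {ρ₀ u₀ : ℝ → ℝ} {x : ℝ}
    (hlt : LamM μ ρ₀ u₀ x < LamP μ ρ₀ u₀ x) : 0 < ρ₀ x := by
  by_contra hcon
  have := div_nonpos_of_nonneg_of_nonpos hμ.le (not_lt.1 hcon)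
  simp only [LamM, LamP] at hlt
  linarith

theorem density_eq_massDensity {μ : ℝ} (hμ : 0 < μ) {ρ₀ u₀ : ℝ → ℝ} {x : ℝ} (hρ : 0 < ρ₀ x) :
    ρ₀ x = 2 * μ * massDensity (LamM μ ρ₀ u₀) (LamP μ ρ₀ u₀) x := by
  have e : LamP μ ρ₀ u₀ x - LamM μ ρ₀ u₀ x = 2 * μ / ρ₀ x := by
    simp only [LamM, LamP]
    ring
  rw [massDensity, e]
  field_simp

theorem charData_of_gas {μ : ℝ} (hμ : 0 < μ) {ρ₀ u₀ : ℝ → ℝ} (hρ₀ : Continuous ρ₀)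
    (hu₀ : Continuous u₀) (hu₀b : ∃ M : ℝ, ∀ x, |u₀ x| ≤ M) (hmass : ¬ Integrable ρ₀)
    (hlt : ∀ x, LamM μ ρ₀ u₀ x < LamP μ ρ₀ u₀ x) (hαβ : α₀ < β₀)
    (heq : LamM μ ρ₀ u₀ α₀ = LamP μ ρ₀ u₀ β₀)
    (huniq : ∀ α β, α < β → LamM μ ρ₀ u₀ α = LamP μ ρ₀ u₀ β → α = α₀ ∧ β = β₀) :
    CharData (LamM μ ρ₀ u₀) (LamP μ ρ₀ u₀) α₀ β₀ := by
  have hpos : ∀ x, 0 < ρ₀ x := fun x => density_pos_of_lam_lt hμ (hlt x)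
  have hq : Continuous fun x => μ / ρ₀ x := continuous_const.div hρ₀ fun x => (hpos x).ne'
  have hm : Continuous (LamM μ ρ₀ u₀) := hu₀.sub hq
  have hp : Continuous (LamP μ ρ₀ u₀) := hu₀.add hq
  refine ⟨hm, hp, hlt, ?_, fun hint => hmass ?_, hαβ, heq, gap_of_unique hm hp hlt huniq⟩
  · obtain ⟨M, hM⟩ := hu₀b
    refine ⟨2 * M, fun x => ?_⟩
    rw [show LamP μ ρ₀ u₀ x + LamM μ ρ₀ u₀ x = 2 * u₀ x by simp only [LamM, LamP]; ring, abs_mul,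
      abs_two]
    linarith [hM x]
  · exact (hint.const_mul (2 * μ)).congr
      (ae_of_all _ fun x => (density_eq_massDensity hμ (hpos x)).symm)

/-- The constants of the two-sided control depend only on the local data. -/
theorem exists_scale_constants (d : LocalData) : ∃ c C : ℝ, 0 < c ∧ 0 < C ∧
    ∀ (μ : ℝ) (Λm Λp : ℝ → ℝ) (α₀ β₀ : ℝ), CharData Λm Λp α₀ β₀ →
      ContDiff ℝ 2 Λm → ContDiff ℝ 2 Λp → Λm α₀ = 0 → Λp β₀ = 0 →
      deriv Λm α₀ = 0 → deriv Λp β₀ = 0 → deriv (deriv Λm) α₀ < 0 → 0 < deriv (deriv Λp) β₀ →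
      d = localData μ Λm Λp α₀ β₀ →
      ∀ᶠ p in 𝓝 (charMap Λm Λp (α₀, β₀)),
        ∃ N, SingularScale c C Λm Λp (charMap Λm Λp (α₀, β₀)) p N := by
  by_cases hd : 0 < d.lamP_alpha ∧ d.lamM_beta < 0 ∧ d.lamM_alpha_deriv2 < 0 ∧
      0 < d.lamP_beta_deriv2
  · obtain ⟨h1, h2, h3, h4⟩ := hd
    -- These are the mass densities at `α₀` and `β₀`, where `Λ₋(α₀) = 0` and `Λ₊(β₀) = 0`.
    set gα := 1 / (d.lamP_alpha - 0)
    set gβ := 1 / (0 - d.lamM_beta)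
    have hgα : 0 < gα := one_div_pos.2 (by linarith)
    have hgβ : 0 < gβ := one_div_pos.2 (by linarith)
    have hDα : 0 < -d.lamM_alpha_deriv2 := by linarith
    set c := min (-d.lamM_alpha_deriv2 / (16 * gα ^ 2)) (d.lamP_beta_deriv2 / (16 * gβ ^ 2))
    have hc : 0 < c := lt_min (by positivity) (by positivity)
    set C := max c (max (4 * -d.lamM_alpha_deriv2 / gα ^ 2) (4 * d.lamP_beta_deriv2 / gβ ^ 2))
    have hcC : c ≤ C := le_max_left _ _
    refine ⟨c / 96, C, by positivity, hc.trans_le hcC, ?_⟩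
    rintro μ Λm Λp α₀ β₀ h hm hp hm0 hp0 hm1 hp1 hm2 hp2 rfl
    exact h.eventually_singularScale hm hp hm0 hp0 hm1 hp1 rfl rfl hDα h4
      (by rw [massDensity, hm0]; rfl) (by rw [massDensity, hp0]; rfl) hc hcC
      (min_le_left _ _) (min_le_right _ _) ((le_max_left _ _).trans (le_max_right _ _))
      ((le_max_right _ _).trans (le_max_right _ _))
  -- Local data with other signs cannot arise from admissible `Λ±`, so any constants serve.
  · refine ⟨1, 1, one_pos, one_pos, ?_⟩
    rintro μ Λm Λp α₀ β₀ h - - hm0 hp0 - - hm2 hp2 rfl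
    refine absurd ⟨?_, ?_, hm2, hp2⟩ hd
    · have := h.lt α₀
      rwa [hm0] at this
    · have := h.lt β₀
      rwa [hp0] at this

end Chaplygin

theorem theorem6p1 :
    ∃ (B₁ B₂ B₃ B₄ B₅ : LocalData → ℝ) (B₆ : ℝ → LocalData → ℝ),
      (∀ d, 0 < B₁ d ∧ 0 < B₂ d ∧ 0 < B₃ d ∧ 0 < B₄ d ∧ 0 < B₅ d ∧ ∀ c, 0 < B₆ c d) ∧
      ∀ (k : ℕ∞) (_hk : 2 ≤ k) (μ p₀ : ℝ) (_hμ : 0 < μ) (_hp₀ : 0 < p₀) (ρ₀ u₀ : ℝ → ℝ)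
        (_hρ₀ : ContDiff ℝ k ρ₀) (_hu₀ : ContDiff ℝ k u₀)
        (_hρ₀b : ∃ M : ℝ, ∀ x, |ρ₀ x| ≤ M) (_hu₀b : ∃ M : ℝ, ∀ x, |u₀ x| ≤ M)
        (_hmass : ¬ Integrable ρ₀)
        (Λm Λp : ℝ → ℝ) (_hΛm : Λm = LamM μ ρ₀ u₀) (_hΛp : Λp = LamP μ ρ₀ u₀)
        (_hA1 : ∀ x, Λm x < Λp x)
        (α₀ β₀ : ℝ) (_hαβ : α₀ < β₀)
        (_hA2 : Λm α₀ = 0 ∧ Λp β₀ = 0)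
        (_hA3 : deriv Λm α₀ = 0 ∧ deriv Λp β₀ = 0)
        (_hA4 : deriv (deriv Λm) α₀ < 0 ∧ 0 < deriv (deriv Λp) β₀)
        (_huniq : ∀ α β, α < β → Λm α = Λp β → α = α₀ ∧ β = β₀)
        (t₀ x₀ : ℝ) (_h₀ : (t₀, x₀) = charMap Λm Λp (α₀, β₀))
        (d : LocalData) (_hd : d = localData μ Λm Λp α₀ β₀),
        -- the solution by characteristics exists on the whole half-plane
        BijOn (charMap Λm Λp) paramSet halfPlane ∧
        IsCharacteristicSolution Λm Λp (lamM Λm Λp) (lamP Λm Λp) ∧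
        -- regime `x - x₀ = o((t - t₀)³)`
        (∀ l : Filter (ℝ × ℝ), l ≤ 𝓝[≠] (t₀, x₀) →
          (fun p : ℝ × ℝ => p.2 - x₀) =o[l] (fun p : ℝ × ℝ => (p.1 - t₀) ^ 3) →
          ∀ᶠ p in l,
            density μ Λm Λp p ≤ ENNReal.ofReal (B₁ d * |p.1 - t₀| ^ (-2 : ℝ)) ∧
            |velocity Λm Λp p| ≤ B₄ d * |p.1 - t₀| ^ (2 : ℝ)) ∧
        -- regime `(t - t₀)³ = o(x - x₀)`
        (∀ l : Filter (ℝ × ℝ), l ≤ 𝓝[≠] (t₀, x₀) →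
          (fun p : ℝ × ℝ => (p.1 - t₀) ^ 3) =o[l] (fun p : ℝ × ℝ => p.2 - x₀) →
          ∀ᶠ p in l,
            density μ Λm Λp p ≤ ENNReal.ofReal (B₂ d * |p.2 - x₀| ^ (-(2 / 3) : ℝ)) ∧
            |velocity Λm Λp p| ≤ B₅ d * |p.2 - x₀| ^ (2 / 3 : ℝ)) ∧
        -- regime where `x - x₀` and `(t - t₀)³` are of the same order
        (∀ c C : ℝ, 0 < c → 0 < C → ∀ l : Filter (ℝ × ℝ), l ≤ 𝓝[≠] (t₀, x₀) →
          (∀ᶠ p in l, c * |p.1 - t₀| ^ 3 ≤ |p.2 - x₀| ∧ |p.2 - x₀| ≤ C * |p.1 - t₀| ^ 3) →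
          ∀ᶠ p in l,
            density μ Λm Λp p ≤ ENNReal.ofReal (B₃ d * |p.2 - x₀| ^ (-(2 / 3) : ℝ)) ∧
            |velocity Λm Λp p| ≤ B₆ c d * |p.2 - x₀| ^ (2 / 3 : ℝ)) ∧
        -- the solution is Delta-like, with the single singular point `(t₀, x₀)`
        IsDeltaLikeSolution k μ p₀ ρ₀ u₀ (density μ Λm Λp) (velocity Λm Λp) {(t₀, x₀)} := by
  choose c C hc hC key using exists_scale_constants
  -- The constants must be positive for every `d` and every real `e`, which explains the default `1`
  -- for `d.mu ≤ 0` and the `|e|` in the last one.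
  refine ⟨fun d => if 0 < d.mu then 2 * d.mu / c d else 1,
    fun d => if 0 < d.mu then 2 * d.mu / c d * C d ^ (2 / 3 : ℝ) else 1,
    fun d => if 0 < d.mu then 2 * d.mu / c d * C d ^ (2 / 3 : ℝ) else 1,
    fun d => 16 * C d, fun d => C d * (64 / 1 + 1 / c d) ^ (2 / 3 : ℝ),
    fun e d => C d * (64 / |e| + 1 / c d) ^ (2 / 3 : ℝ), fun d => ?_, ?_⟩
  · have hcd := hc d
    have hCd := hC d
    refine ⟨?_, ?_, ?_, by positivity, by positivity, fun e => by positivity⟩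
    all_goals
      dsimp only
      split_ifs
      · positivity
      · exact one_pos
  intro k hk μ p₀ hμ hp₀ ρ₀ u₀ hρ₀ hu₀ hρ₀b hu₀b hmass Λm Λp hΛm hΛp hA1 α₀ β₀ hαβ hA2 hA3 hA4
    huniq t₀ x₀ h₀ d hd
  have h : CharData Λm Λp α₀ β₀ := by
    subst hΛm hΛp
    exact charData_of_gas hμ hρ₀.continuous hu₀.continuous hu₀b hmass hA1 hαβ
      (hA2.1.trans hA2.2.symm) huniq
  have hpos : ∀ x, 0 < ρ₀ x := fun x => by
    have := hA1 x
    rw [hΛm, hΛp] at this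
    exact density_pos_of_lam_lt hμ this
  have hq : ContDiff ℝ k fun x => μ / ρ₀ x := contDiff_const.div hρ₀ fun x => (hpos x).ne'
  have hm : ContDiff ℝ k Λm := hΛm ▸ hu₀.sub hq
  have hp : ContDiff ℝ k Λp := hΛp ▸ hu₀.add hq
  have hk2 : (2 : WithTop ℕ∞) ≤ k := WithTop.coe_le_coe.2 hk
  have hk0 : k ≠ 0 := by
    rintro rfl
    exact absurd hk (by decide)
  have hev : ∀ᶠ p in 𝓝 (t₀, x₀), ∃ N, SingularScale (c d) (C d) Λm Λp (t₀, x₀) p N := by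
    rw [h₀]
    exact key d μ Λm Λp α₀ β₀ h (hm.of_le hk2) (hp.of_le hk2) hA2.1 hA2.2 hA3.1 hA3.2 hA4.1
      hA4.2 hd
  have hdμ : d.mu = μ := by rw [hd]; rfl
  have hfil : ∀ l : Filter (ℝ × ℝ), l ≤ 𝓝[≠] (t₀, x₀) → ∀ᶠ p in l,
      (∃ N, SingularScale (c d) (C d) Λm Λp (t₀, x₀) p N) ∧ p ≠ (t₀, x₀) := fun l hl =>
    hl ((hev.filter_mono nhdsWithin_le_nhds).and self_mem_nhdsWithin)
  simp only [hdμ, if_pos hμ]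
  refine ⟨h.bijOn_charMap, h.isCharacteristicSolution, ?_, ?_, ?_, ?_⟩
  · intro l hl ho
    -- The little-o condition is used only with the constant `c d` that `velocity_le_time` needs. If
    -- `t = t₀`, it forces `x = x₀`, which the punctured filter excludes.
    filter_upwards [hfil l hl, ho.bound (hc d)] with p ⟨⟨N, hs⟩, hne⟩ hb
    rw [Real.norm_eq_abs, Real.norm_eq_abs, abs_pow] at hb
    refine ⟨hs.density_le_time hμ (hc d) hne fun ht => hne ?_, hs.velocity_le_time (hc d) (hC d) hb⟩
    rw [ht] at hb
    have hb' : |p.2 - x₀| ≤ 0 := by simpa using hb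
    exact Prod.ext (sub_eq_zero.1 ht) (sub_eq_zero.1 (abs_nonpos_iff.1 hb'))
  · intro l hl ho
    -- The constant `1` makes this the case `e = 1` of `velocity_le_space`.
    filter_upwards [hfil l hl, ho.bound one_pos] with p ⟨⟨N, hs⟩, hne⟩ hb
    rw [Real.norm_eq_abs, Real.norm_eq_abs, abs_pow, one_mul] at hb
    refine ⟨hs.density_le_space hμ (hc d) (hC d) hne fun hx => hne ?_,
      hs.velocity_le_space (hc d) (hC d) one_pos (by rwa [one_mul])⟩
    rw [hx, abs_zero] at hb
    exact Prod.ext (sub_eq_zero.1 (abs_nonpos_iff.1 (pow_eq_zero_iff three_ne_zero |>.1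
      (le_antisymm hb (by positivity))).le)) (sub_eq_zero.1 hx)
  · intro e E he hE l hl ho
    filter_upwards [hfil l hl, ho] with p ⟨⟨N, hs⟩, hne⟩ hb
    rw [abs_of_pos he]
    refine ⟨hs.density_le_space hμ (hc d) (hC d) hne fun hx => hne ?_,
      hs.velocity_le_space (hc d) (hC d) he hb.1⟩
    have hb1 := hb.1
    rw [hx, abs_zero] at hb1
    have hb2 : |p.1 - t₀| ^ 3 ≤ 0 := nonpos_of_mul_nonpos_right hb1 he
    exact Prod.ext (sub_eq_zero.1 (abs_nonpos_iff.1 (pow_eq_zero_iff three_ne_zero |>.1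
      (le_antisymm hb2 (by positivity))).le)) (sub_eq_zero.1 hx)
  · rw [h₀]
    refine h.isDeltaLikeSolution hk0 hμ hm hp (h.isWeakSolution hμ hρ₀.continuous
      hu₀.continuous hρ₀b hu₀b (fun x => ?_) fun x => ?_)
    · rw [hΛm, hΛp]
      exact density_eq_massDensity hμ (hpos x)
    · rw [hΛm, hΛp]
      simp only [LamM, LamP]
      ring
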